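/- Let $(t,x,y,u,v)$ be the standard coordinates on $\mathbb R^5$. For a nonempty open interval $I\subseteq\mathbb R$ let $\mathfrak g_{\rm L}(I)$ be the Lie algebra of vector fields on $I\times\mathbb R^4$ (with $t\in I$) spanned over $\mathbb R$ by \begin{gather*} \bar D^t(\tau)=\tau\partial_t+\tfrac13\tau_tx\partial_x+\tfrac13\tau_ty\partial_y-\tfrac1{18}\tau_{tt}(x^3+y^3)\partial_u,\quad \bar D^{\rm s}=x\partial_x+y\partial_y+3u\partial_u+\tfrac32v\partial_v,\\ \bar P^x(\chi)=\chi\partial_x-\tfrac12\chi_tx^2\partial_u,\quad \bar P^y(\rho)=\rho\partial_y-\tfrac12\rho_ty^2\partial_u,\\ \bar R^x(\alpha)=\alpha x\partial_u,\quad \bar R^y(\beta)=\beta y\partial_u,\quad \bar Z(\sigma)=\sigma\partial_u,\quad \bar P^v=\partial_v, \end{gather*} where $\tau,\chi,\rho,\alpha,\beta,\sigma$ run through the smooth real functions of $t\in I$. (This is the known explicit form of the maximal Lie invariance algebra $\mathfrak g_{\rm L}$ of the nonlinear Lax representation $v_t=\frac13(v_x^3-u_{xy}^3v_x^{-3})+u_{xx}v_x-u_{xy}u_{yy}v_x^{-1}$,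 $v_y=-u_{xy}v_x^{-1}$ of the dispersionless Nizhnik equation; its point-symmetry pseudogroup is the following $G_{\rm L}$.) Let $G_{\rm L}$ be the pseudogroup of local homeomorphisms of $\mathbb R^5$ generated by the permutation $(t,x,y,u,v)\mapsto(t,y,x,u,v)$ and the transformations \begin{gather*} \tilde t=T(t),\quad \tilde x=A^{2/3}T_t^{1/3}x+X^0(t),\quad \tilde y=A^{2/3}T_t^{1/3}y+Y^0(t),\\ \tilde u=A^2u-\frac{A^2T_{tt}}{18T_t}(x^3+y^3)-\frac{A^{4/3}}{2T_t^{1/3}}(X^0_tx^2+Y^0_ty^2)+W^1(t)x+W^2(t)y+W^0(t),\quad \tilde v=Av+B, \end{gather*} where $T,X^0,Y^0,W^0,W^1,W^2$ are smooth functions on an open interval with $T_t\ne0$ everywhere, $A,B\in\mathbb R$ with $A\neq0$, and the fractional powers are those of the real cube root. Spaces of vector fields $\mathfrak s$ on $I\times\mathbb R^4$ and $\mathfrak s'$ on $J\times\mathbb R^4$ are called $G_{\rm L}$-equivalent if some $\Phi\in G_{\rm L}$ with domain $I\times\mathbb R^4$ and image $J\times\mathbb R^4$ pushes $\mathfrak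 s$ forward onto $\mathfrak s'$. For each nonempty open interval $I$ consider the following list, where $\delta,\delta'\in\{0,1\}$, and $\rho$ and $\beta$ run through the smooth functions on $I$, with $\rho$ vanishing nowhere: \begin{gather*} \bar{\mathfrak s}_{1.1}^{\delta\delta'}=\langle\bar D^t(1)+\delta\bar D^{\rm s}+\delta'\bar P^v\rangle\ (\delta\delta'=0),\quad \bar{\mathfrak s}_{1.2}=\langle\bar D^{\rm s}\rangle,\quad \bar{\mathfrak s}_{1.3}^{\rho\delta}=\langle\bar P^x(1)+\bar P^y(\rho)+\delta\bar P^v\rangle,\\ \bar{\mathfrak s}_{1.4}^{\beta\delta}=\langle\bar P^x(1)+\bar R^y(\beta)+\delta\bar P^v\rangle,\quad \bar{\mathfrak s}_{1.5}^{\beta\delta}=\langle\bar R^x(1)+\bar R^y(\beta)+\delta\bar P^v\rangle,\\ \bar{\mathfrak s}_{1.6}^{\delta}=\langle\bar Z(t)+\delta\bar P^v\rangle,\quad \bar{\mathfrak s}_{1.7}^{\delta}=\langle\bar Z(1)+\delta\bar P^v\rangle,\quad \bar{\mathfrak s}_{1.8}=\langle\bar P^v\rangle. \end{gather*} This is a complete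 list of $G_{\rm L}$-inequivalent one-dimensional subalgebras of $\mathfrak g_{\rm L}$ in the following sense. (i) Every member of the list on $I$ is a one-dimensional subalgebra of $\mathfrak g_{\rm L}(I)$. (ii) Let $\mathfrak s$ be a one-dimensional subalgebra of $\mathfrak g_{\rm L}(I)$. Every nonempty open interval $K\subseteq I$ such that $\mathfrak s$ does not vanish identically on $K\times\mathbb R^4$ contains a nonempty open interval $I'$ such that the restriction of $\mathfrak s$ to $I'\times\mathbb R^4$ is $G_{\rm L}$-equivalent to a member of the list on some nonempty open interval $J$. (iii) For any nonempty open intervals $I$ and $J$, a member of the list on $I$ and a member of the list on $J$ are not $G_{\rm L}$-equivalent if they belong to different ones of the eight families or to the same family but with different values of the constant parameters $\delta$, $\delta'$. (Within the families parameterized by functions, members that differ only in $\rho$ or $\beta$ may be equivalent.) -/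

import Mathlib

open scoped ContDiff

namespace DNLax

noncomputable section

/-- The space with coordinates `(t, x, y, u, v) = (p 0, p 1, p 2, p 3, p 4)`. -/
abbrev E : Type := Fin 5 → ℝ

/-- Nonempty open intervals of the real line, the domains of the parameter functions of `t`. -/
def IsOpenInterval (I : Set ℝ) : Prop := I.Nonempty ∧ IsOpen I ∧ I.OrdConnected

/-- The domain `I × ℝ⁴` in the space of the variables `(t, x, y, u, v)`. -/
def slab (I : Set ℝ) : Set E := {p | p 0 ∈ I}

/-- Vector fields on `I × ℝ⁴`, given by the tuples of their components
with respect to `∂_t, ∂_x, ∂_y, ∂_u, ∂_v`. -/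
abbrev VF (I : Set ℝ) : Type := slab I → E

/-- Extension of a vector field by zero to the whole space; only its values on `I × ℝ⁴` matter. -/
def VF.ext {I : Set ℝ} (Q : VF I) : E → E := Function.extend Subtype.val Q 0

/-- The Lie bracket of vector fields on `I × ℝ⁴`. -/
def bracket {I : Set ℝ} (Q R : VF I) : VF I :=
  fun p => VectorField.lieBracket ℝ Q.ext R.ext p.1

/-- Restriction of vector fields to a smaller interval of values of `t`. -/
def restrictVF {I K : Set ℝ} (h : K ⊆ I) : VF I →ₗ[ℝ] VF K where
  toFun Q := fun p => Q ⟨p.1, h p.2⟩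
  map_add' _ _ := rfl
  map_smul' _ _ := rfl

/-! ### The spanning vector fields of the algebra -/

/-- `τ ∂_t + (1/3) τ_t x ∂_x + (1/3) τ_t y ∂_y - (1/18) τ_tt (x³ + y³) ∂_u`. -/
def Dt (I : Set ℝ) (τ : ℝ → ℝ) : VF I := fun p =>
  ![τ (p.1 0), 1 / 3 * deriv τ (p.1 0) * p.1 1, 1 / 3 * deriv τ (p.1 0) * p.1 2,
    -(1 / 18) * deriv (deriv τ) (p.1 0) * (p.1 1 ^ 3 + p.1 2 ^ 3), 0]

/-- `x ∂_x + y ∂_y + 3 u ∂_u + (3/2) v ∂_v`. -/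
def Ds (I : Set ℝ) : VF I := fun p => ![0, p.1 1, p.1 2, 3 * p.1 3, 3 / 2 * p.1 4]

/-- `χ ∂_x - (1/2) χ_t x² ∂_u`. -/
def Px (I : Set ℝ) (χ : ℝ → ℝ) : VF I := fun p =>
  ![0, χ (p.1 0), 0, -(1 / 2) * deriv χ (p.1 0) * p.1 1 ^ 2, 0]

/-- `ρ ∂_y - (1/2) ρ_t y² ∂_u`. -/
def Py (I : Set ℝ) (ρ : ℝ → ℝ) : VF I := fun p =>
  ![0, 0, ρ (p.1 0), -(1 / 2) * deriv ρ (p.1 0) * p.1 2 ^ 2, 0]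

/-- `α x ∂_u`. -/
def Rx (I : Set ℝ) (α : ℝ → ℝ) : VF I := fun p => ![0, 0, 0, α (p.1 0) * p.1 1, 0]

/-- `β y ∂_u`. -/
def Ry (I : Set ℝ) (β : ℝ → ℝ) : VF I := fun p => ![0, 0, 0, β (p.1 0) * p.1 2, 0]

/-- `σ ∂_u`. -/
def Z (I : Set ℝ) (σ : ℝ → ℝ) : VF I := fun p => ![0, 0, 0, σ (p.1 0), 0]

/-- `∂_v`. -/
def Pv (I : Set ℝ) : VF I := fun _ => ![0, 0, 0, 0, 1]

/-- The Lie algebra `𝔤_L` over the interval `I`: the span of the above vector fields,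
where the parameter functions run through the smooth functions of `t ∈ I`. -/
def gL (I : Set ℝ) : Submodule ℝ (VF I) :=
  Submodule.span ℝ
    (Dt I '' {f | ContDiffOn ℝ ∞ f I} ∪ {Ds I} ∪
      Px I '' {f | ContDiffOn ℝ ∞ f I} ∪ Py I '' {f | ContDiffOn ℝ ∞ f I} ∪
      Rx I '' {f | ContDiffOn ℝ ∞ f I} ∪ Ry I '' {f | ContDiffOn ℝ ∞ f I} ∪
      Z I '' {f | ContDiffOn ℝ ∞ f I} ∪ {Pv I})

/-- One-dimensional Lie subalgebras of `𝔤_L` over `I`. -/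
def IsOneDimSubalgebra (I : Set ℝ) (s : Submodule ℝ (VF I)) : Prop :=
  s ≤ gL I ∧ (∀ Q ∈ s, ∀ R ∈ s, bracket Q R ∈ s) ∧ Module.finrank ℝ s = 1

/-! ### The pseudogroup -/

/-- The real cube root. -/
def cbrt (r : ℝ) : ℝ := (SignType.sign r : ℝ) * |r| ^ (1 / 3 : ℝ)

/-- The point transformation
`t̃ = T`, `x̃ = A^{2/3} T_t^{1/3} x + X`, `ỹ = A^{2/3} T_t^{1/3} y + Y`,
`ũ = A² u - A² T_tt / (18 T_t) (x³ + y³) - A^{4/3} / (2 T_t^{1/3}) (X_t x² + Y_t y²)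
  + W₁ x + W₂ y + W₀`, `ṽ = A v + B`. -/
def formMap (T X Y W₀ W₁ W₂ : ℝ → ℝ) (A B : ℝ) (p : E) : E :=
  ![T (p 0),
    cbrt A ^ 2 * cbrt (deriv T (p 0)) * p 1 + X (p 0),
    cbrt A ^ 2 * cbrt (deriv T (p 0)) * p 2 + Y (p 0),
    A ^ 2 * p 3 - A ^ 2 * deriv (deriv T) (p 0) / (18 * deriv T (p 0)) * (p 1 ^ 3 + p 2 ^ 3)
      - cbrt A ^ 4 / (2 * cbrt (deriv T (p 0))) *
          (deriv X (p 0) * p 1 ^ 2 + deriv Y (p 0) * p 2 ^ 2)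
      + W₁ (p 0) * p 1 + W₂ (p 0) * p 2 + W₀ (p 0),
    A * p 4 + B]

/-- `e` is a transformation of the above form whose parameter functions are smooth functions
on an open interval `I`, with `T_t ≠ 0` and `A ≠ 0`. -/
def IsFormTransformation (e : OpenPartialHomeomorph E E) : Prop :=
  ∃ (I : Set ℝ) (T X Y W₀ W₁ W₂ : ℝ → ℝ) (A B : ℝ),
    IsOpenInterval I ∧
    ContDiffOn ℝ ∞ T I ∧ ContDiffOn ℝ ∞ X I ∧ ContDiffOn ℝ ∞ Y I ∧
    ContDiffOn ℝ ∞ W₀ I ∧ ContDiffOn ℝ ∞ W₁ I ∧ ContDiffOn ℝ ∞ W₂ I ∧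
    (∀ t ∈ I, deriv T t ≠ 0) ∧ A ≠ 0 ∧
    e.source = slab I ∧ ∀ p ∈ slab I, e p = formMap T X Y W₀ W₁ W₂ A B p

/-- `e` is the permutation `(t, x, y, u, v) ↦ (t, y, x, u, v)`. -/
def IsSwap (e : OpenPartialHomeomorph E E) : Prop :=
  e.source = Set.univ ∧ ∀ p, e p = ![p 0, p 2, p 1, p 3, p 4]

/-- The pseudogroup `G_L`: the smallest pseudogroup of local homeomorphisms of the space
of `(t, x, y, u, v)` that contains the above transformations. -/
def GLax : StructureGroupoid E :=
  sInf {G | ∀ e, IsFormTransformation e ∨ IsSwap e → e ∈ G}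

/-- The pushforward by `Φ` of a vector field on `I × ℝ⁴` to a vector field on `J × ℝ⁴`;
it is used only if `Φ` maps `I × ℝ⁴` onto `J × ℝ⁴`. -/
def pushforward (Φ : OpenPartialHomeomorph E E) {I : Set ℝ} (J : Set ℝ) (Q : VF I) : VF J :=
  fun q => fderiv ℝ Φ (Φ.symm q.1) (Q.ext (Φ.symm q.1))

/-- `G_L`-equivalence of a space of vector fields on `I × ℝ⁴`
and a space of vector fields on `J × ℝ⁴`. -/
def GLEquivalent {I J : Set ℝ} (s : Submodule ℝ (VF I)) (s' : Submodule ℝ (VF J)) : Prop :=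
  ∃ Φ ∈ GLax, Φ.source = slab I ∧ Φ.target = slab J ∧
    (s' : Set (VF J)) = pushforward Φ J '' (s : Set (VF I))

/-! ### The list -/

/-- The families of the list, together with the values of their constant parameters. -/
inductive Family : Type
  | s1 (δ δ' : ℝ)
  | s2
  | s3 (δ : ℝ)
  | s4 (δ : ℝ)
  | s5 (δ : ℝ)
  | s6 (δ : ℝ)
  | s7 (δ : ℝ)
  | s8

/-- `IsListed I F s`: the space `s` of vector fields on `I × ℝ⁴` belongs to the family `F`. -/
def IsListed (I : Set ℝ) : Family → Submodule ℝ (VF I) → Prop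
  | .s1 δ δ', s => (δ = 0 ∨ δ = 1) ∧ (δ' = 0 ∨ δ' = 1) ∧ δ * δ' = 0 ∧
      s = Submodule.span ℝ {Dt I (fun _ => 1) + δ • Ds I + δ' • Pv I}
  | .s2, s => s = Submodule.span ℝ {Ds I}
  | .s3 δ, s => (δ = 0 ∨ δ = 1) ∧ ∃ ρ : ℝ → ℝ, ContDiffOn ℝ ∞ ρ I ∧ (∀ t ∈ I, ρ t ≠ 0) ∧
      s = Submodule.span ℝ {Px I (fun _ => 1) + Py I ρ + δ • Pv I}
  | .s4 δ, s => (δ = 0 ∨ δ = 1) ∧ ∃ β : ℝ → ℝ, ContDiffOn ℝ ∞ β I ∧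
      s = Submodule.span ℝ {Px I (fun _ => 1) + Ry I β + δ • Pv I}
  | .s5 δ, s => (δ = 0 ∨ δ = 1) ∧ ∃ β : ℝ → ℝ, ContDiffOn ℝ ∞ β I ∧
      s = Submodule.span ℝ {Rx I (fun _ => 1) + Ry I β + δ • Pv I}
  | .s6 δ, s => (δ = 0 ∨ δ = 1) ∧ s = Submodule.span ℝ {Z I (fun t => t) + δ • Pv I}
  | .s7 δ, s => (δ = 0 ∨ δ = 1) ∧ s = Submodule.span ℝ {Z I (fun _ => 1) + δ • Pv I}
  | .s8, s => s = Submodule.span ℝ {Pv I}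

end

end DNLax

open scoped ContDiff

namespace DNLax

open Set Filter Topology

/-! Inequivalence rests on the derivatives of the pseudogroup elements. For each generator the
derivative is block triangular: it scales the t-direction, scales and possibly exchanges the x- and
y-directions, multiplies u by `A ^ 2` on vectors pointing along u and v only, and multiplies v by
`A`, with `A` constant. This property is local and stable under composition and inversion, so by
minimality it holds, with locally constant `A`, for all of `GLax` (`locallyShaped_of_mem_GLax`).
Hence a line of vector fields has these invariant properties, each implying the previous ones: the
t-component vanishes; moreover at each point the x- or the y-component vanishes; both vanish; the
u-component then depends, infinitesimally, on t only; it has zero differential; it is zero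
(`LineRel.level`). The last property that holds determines the family, except that the dilation and
the third family share a level. Whether the v-component vanishes identically or nowhere separates
these two and the values of the constant parameters (`IsListed.family_eq`).

Completeness is a normalization of the general element `genField`. The action of the generators is
computed in `carries_shift`, `carries_swap`, `carries_straighten` and `exists_carries_scale`. The
pivot is the first nonzero datum among τ, the dilation coefficient c, the pair χ, ρ, the pair α, β,
the derivative of σ, and finally the constants. Shifts remove the lower coefficients by solving
linear first-order ODEs or algebraic equations; a reparameterization of t and the constant `A` then
normalize the pivot and the ∂_v-coefficient. A functional pivot may have zeros without vanishing
identically, so the interval is shrunk to where it has none (`exists_normalizable`).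

That the listed lines are subalgebras is immediate, since multiples of one field commute. -/

/-! ### Real analysis on open intervals -/

theorem cbrt_pow_three (r : ℝ) : cbrt r ^ 3 = r := by
  have h : (|r| ^ (1 / 3 : ℝ)) ^ 3 = |r| := by
    rw [← Real.rpow_natCast, ← Real.rpow_mul (abs_nonneg r)]; norm_num
  rw [cbrt, mul_pow, h]
  rcases lt_trichotomy r 0 with hr | hr | hr
  · rw [abs_of_neg hr, sign_neg hr]; norm_num
  · simp [hr]
  · rw [abs_of_pos hr, sign_pos hr]; simp

theorem cbrt_ne_zero {r : ℝ} (hr : r ≠ 0) : cbrt r ≠ 0 := fun h => by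
  apply hr; rw [← cbrt_pow_three r, h]; norm_num

theorem cbrt_one : cbrt 1 = 1 := by simp [cbrt]

theorem contDiffAt_cbrt {r : ℝ} (hr : r ≠ 0) : ContDiffAt ℝ ∞ cbrt r := by
  rcases lt_or_gt_of_ne hr with h | h
  · have : ContDiffAt ℝ ∞ (fun s : ℝ => -(-s) ^ (1 / 3 : ℝ)) r :=
      ((Real.contDiffAt_rpow_const_of_ne (neg_ne_zero.2 hr)).comp r contDiffAt_id.neg).neg
    refine this.congr_of_eventuallyEq ?_
    filter_upwards [Iio_mem_nhds h] with s hs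
    simp [cbrt, sign_neg (mem_Iio.1 hs), abs_of_neg (mem_Iio.1 hs)]
  · have : ContDiffAt ℝ ∞ (fun s : ℝ => s ^ (1 / 3 : ℝ)) r :=
      Real.contDiffAt_rpow_const_of_ne hr
    refine this.congr_of_eventuallyEq ?_
    filter_upwards [Ioi_mem_nhds h] with s hs
    simp [cbrt, sign_pos (mem_Ioi.1 hs), abs_of_pos (mem_Ioi.1 hs)]

theorem contDiffOn_deriv {I : Set ℝ} (hI : IsOpen I) {f : ℝ → ℝ}
    (hf : ContDiffOn ℝ ∞ f I) : ContDiffOn ℝ ∞ (deriv f) I :=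
  ((contDiffOn_infty_iff_deriv_of_isOpen hI).1 hf).2

theorem hasDerivAt_of_contDiffOn {I : Set ℝ} (hI : IsOpen I) {f : ℝ → ℝ}
    (hf : ContDiffOn ℝ ∞ f I) {t : ℝ} (ht : t ∈ I) : HasDerivAt f (deriv f t) t :=
  ((hf.differentiableOn (by simp)).differentiableAt (hI.mem_nhds ht)).hasDerivAt

theorem contDiffOn_of_hasDerivAt {I : Set ℝ} (hI : IsOpen I) {F f : ℝ → ℝ}
    (hf : ContDiffOn ℝ ∞ f I) (h : ∀ t ∈ I, HasDerivAt F (f t) t) : ContDiffOn ℝ ∞ F I :=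
  (contDiffOn_infty_iff_deriv_of_isOpen hI).2
    ⟨fun t ht => (h t ht).differentiableAt.differentiableWithinAt,
      hf.congr fun t ht => (h t ht).deriv⟩

theorem deriv_eqOn {I : Set ℝ} (hI : IsOpen I) {f g : ℝ → ℝ} (h : EqOn f g I) :
    EqOn (deriv f) (deriv g) I := fun _ ht =>
  (Filter.eventuallyEq_of_mem (hI.mem_nhds ht) h).deriv_eq

theorem exists_antideriv {I : Set ℝ} (hI : IsOpenInterval I) {f : ℝ → ℝ}
    (hf : ContDiffOn ℝ ∞ f I) :
    ∃ F : ℝ → ℝ, ContDiffOn ℝ ∞ F I ∧ ∀ t ∈ I, HasDerivAt F (f t) t := by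
  obtain ⟨⟨a, ha⟩, ho, hc⟩ := hI
  have key : ∀ t ∈ I, HasDerivAt (fun u => ∫ x in a..u, f x) (f t) t := fun t ht =>
    intervalIntegral.integral_hasDerivAt_right
      ((hf.continuousOn.mono (hc.uIcc_subset ha ht)).intervalIntegrable)
      (hf.continuousOn.stronglyMeasurableAtFilter ho t ht)
      (hf.continuousOn.continuousAt (ho.mem_nhds ht))
  exact ⟨_, contDiffOn_of_hasDerivAt ho hf key, key⟩

/-- Variation of constants, with two antiderivatives. Linearity gives a solution on the whole
interval, so solving for shift parameters never costs any shrinking. -/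
theorem exists_linear_ode {I : Set ℝ} (hI : IsOpenInterval I) {p q : ℝ → ℝ}
    (hp : ContDiffOn ℝ ∞ p I) (hq : ContDiffOn ℝ ∞ q I) :
    ∃ y : ℝ → ℝ, ContDiffOn ℝ ∞ y I ∧ ∀ t ∈ I, deriv y t = p t * y t + q t := by
  obtain ⟨P, hP, hP'⟩ := exists_antideriv hI hp
  obtain ⟨R, hR, hR'⟩ := exists_antideriv hI (hP.neg.exp.mul hq)
  refine ⟨fun t => Real.exp (P t) * R t, hP.exp.mul hR, fun t ht => ?_⟩
  have hd : deriv (fun t => Real.exp (P t) * R t) t = _ := ((hP' t ht).exp.mul (hR' t ht)).deriv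
  rw [hd]
  have : Real.exp (P t) * Real.exp (-P t) = 1 := by rw [← Real.exp_add]; simp
  linear_combination q t * this

theorem exists_openInterval_ne_zero {K : Set ℝ} (hK : IsOpenInterval K) {f : ℝ → ℝ}
    (hf : ContinuousOn f K) (h : ¬ ∀ t ∈ K, f t = 0) :
    ∃ I, I ⊆ K ∧ IsOpenInterval I ∧ ∀ t ∈ I, f t ≠ 0 := by
  push Not at h
  obtain ⟨t, ht, hne⟩ := h
  have hmem : K ∩ {s | f s ≠ 0} ∈ 𝓝 t := inter_mem (hK.2.1.mem_nhds ht)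
    ((hf.continuousAt (hK.2.1.mem_nhds ht)).eventually_ne hne)
  obtain ⟨ε, hε, hb⟩ := Metric.mem_nhds_iff.1 hmem
  refine ⟨Metric.ball t ε, fun s hs => (hb hs).1, ⟨⟨t, Metric.mem_ball_self hε⟩,
    Metric.isOpen_ball, ?_⟩, fun s hs => (hb hs).2⟩
  rw [Real.ball_eq_Ioo]; exact ordConnected_Ioo

theorem exists_eq_const {K : Set ℝ} (hK : IsOpenInterval K) {f : ℝ → ℝ}
    (hf : ContDiffOn ℝ ∞ f K) (h : ∀ t ∈ K, deriv f t = 0) : ∃ s, ∀ t ∈ K, f t = s := by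
  obtain ⟨⟨a, ha⟩, ho, hc⟩ := hK
  exact ⟨f a, fun t ht => ho.is_const_of_deriv_eq_zero hc.isPreconnected
    (hf.differentiableOn (by simp)) h ht ha⟩

/-- A smooth function with nowhere vanishing derivative on an open interval, as a
diffeomorphism onto its image. -/
theorem exists_openPartialHomeomorph {I : Set ℝ} (hI : IsOpenInterval I) {T : ℝ → ℝ}
    (hT : ContDiffOn ℝ ∞ T I) (hT' : ∀ t ∈ I, deriv T t ≠ 0) :
    ∃ S : OpenPartialHomeomorph ℝ ℝ, S.source = I ∧ ⇑S = T ∧ IsOpenInterval S.target ∧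
      ContDiffOn ℝ ∞ S.symm S.target := by
  obtain ⟨⟨a, ha⟩, ho, hc⟩ := hI
  -- Injectivity by Rolle's theorem; openness below is the inverse function theorem at each point.
  have aux : ∀ x ∈ I, ∀ y ∈ I, x < y → T x ≠ T y := by
    intro x hx y hy hxy heq
    obtain ⟨c, hc', h0⟩ := exists_deriv_eq_zero hxy
      (hT.continuousOn.mono (hc.out hx hy)) heq
    exact hT' c (hc.out hx hy (Ioo_subset_Icc_self hc')) h0
  have hinj : InjOn T I := by
    intro x hx y hy heq
    rcases lt_trichotomy x y with h | h | h
    · exact absurd heq (aux x hx y hy h)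
    · exact h
    · exact absurd heq.symm (aux y hy x hx h)
  let e : PartialEquiv ℝ ℝ := hinj.toPartialEquiv T I
  have hopen : IsOpenMap (e.source.domRestrict e) := by
    refine isOpenMap_iff_nhds_le.2 fun x => ?_
    have hs : HasStrictDerivAt T (deriv T x) x :=
      (hT.contDiffAt (ho.mem_nhds x.2)).hasStrictDerivAt (by simp)
    have h1 := hs.map_nhds_eq (hT' x x.2)
    have h2 : Filter.map ((↑) : e.source → ℝ) (𝓝 x) = 𝓝 (x : ℝ) :=
      ho.isOpenEmbedding_subtypeVal.map_nhds_eq x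
    change 𝓝 (T x) ≤ Filter.map (T ∘ Subtype.val) (𝓝 x)
    rw [← Filter.map_map, h2, h1]
  let S := OpenPartialHomeomorph.ofContinuousOpenRestrict e hT.continuousOn hopen ho
  refine ⟨S, rfl, rfl, ⟨⟨T a, a, ha, rfl⟩, S.open_target, ?_⟩, fun t ht => ?_⟩
  · exact (hc.isPreconnected.image T hT.continuousOn).ordConnected
  · have hm : S.symm t ∈ I := S.map_target ht
    exact (S.contDiffAt_symm_deriv (hT' _ hm) ht (hasDerivAt_of_contDiffOn ho hT hm)
      (hT.contDiffAt (ho.mem_nhds hm))).contDiffWithinAt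

/-! ### The transformations generating the pseudogroup -/

/-- The general shape of the transformations, with independent coefficient functions. -/
noncomputable def genMap (T a X Y k m₁ m₂ W₀ W₁ W₂ : ℝ → ℝ) (A B : ℝ) (p : E) : E :=
  ![T (p 0), a (p 0) * p 1 + X (p 0), a (p 0) * p 2 + Y (p 0),
    A ^ 2 * p 3 - k (p 0) * (p 1 ^ 3 + p 2 ^ 3) - (m₁ (p 0) * p 1 ^ 2 + m₂ (p 0) * p 2 ^ 2)
      + W₁ (p 0) * p 1 + W₂ (p 0) * p 2 + W₀ (p 0), A * p 4 + B]

theorem formMap_eq_genMap (T X Y W₀ W₁ W₂ : ℝ → ℝ) (A B : ℝ) :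
    formMap T X Y W₀ W₁ W₂ A B = genMap T (fun t => cbrt A ^ 2 * cbrt (deriv T t)) X Y
      (fun t => A ^ 2 * deriv (deriv T) t / (18 * deriv T t))
      (fun t => cbrt A ^ 4 / (2 * cbrt (deriv T t)) * deriv X t)
      (fun t => cbrt A ^ 4 / (2 * cbrt (deriv T t)) * deriv Y t) W₀ W₁ W₂ A B := by
  funext p
  simp only [formMap, genMap]
  congr 5
  ring

/-- The relations between the coefficients of `formMap` are irrelevant for the derivative, so it is
computed for independent ones. The derivative is described by its values on vectors, the only form
used later. -/
theorem hasFDerivAt_genMap {T a X Y k m₁ m₂ W₀ W₁ W₂ : ℝ → ℝ} (A B : ℝ) {p : E}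
    {T' a' X' Y' k' m₁' m₂' W₀' W₁' W₂' : ℝ}
    (hT : HasDerivAt T T' (p 0)) (ha : HasDerivAt a a' (p 0))
    (hX : HasDerivAt X X' (p 0)) (hY : HasDerivAt Y Y' (p 0)) (hk : HasDerivAt k k' (p 0))
    (hm₁ : HasDerivAt m₁ m₁' (p 0)) (hm₂ : HasDerivAt m₂ m₂' (p 0))
    (hW₀ : HasDerivAt W₀ W₀' (p 0)) (hW₁ : HasDerivAt W₁ W₁' (p 0))
    (hW₂ : HasDerivAt W₂ W₂' (p 0)) :
    ∃ D : E →L[ℝ] E, HasFDerivAt (genMap T a X Y k m₁ m₂ W₀ W₁ W₂ A B) D p ∧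
      ∀ w : E, D w = ![T' * w 0, a' * w 0 * p 1 + a (p 0) * w 1 + X' * w 0,
        a' * w 0 * p 2 + a (p 0) * w 2 + Y' * w 0,
        A ^ 2 * w 3 - (k' * w 0 * (p 1 ^ 3 + p 2 ^ 3)
            + k (p 0) * (3 * p 1 ^ 2 * w 1 + 3 * p 2 ^ 2 * w 2))
          - (m₁' * w 0 * p 1 ^ 2 + 2 * m₁ (p 0) * p 1 * w 1
            + m₂' * w 0 * p 2 ^ 2 + 2 * m₂ (p 0) * p 2 * w 2)
          + (W₁' * w 0 * p 1 + W₁ (p 0) * w 1) + (W₂' * w 0 * p 2 + W₂ (p 0) * w 2) + W₀' * w 0,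
        A * w 4] := by
  have pr : ∀ i : Fin 5, HasFDerivAt (fun p : E => p i)
      (ContinuousLinearMap.proj (R := ℝ) (φ := fun _ : Fin 5 => ℝ) i) p :=
    fun i => (ContinuousLinearMap.proj (R := ℝ) (φ := fun _ : Fin 5 => ℝ) i).hasFDerivAt
  have co : ∀ {f : ℝ → ℝ} {f' : ℝ}, HasDerivAt f f' (p 0) →
      HasFDerivAt (fun p : E => f (p 0))
        (f' • ContinuousLinearMap.proj (R := ℝ) (φ := fun _ : Fin 5 => ℝ) 0) p :=
    fun hf => hf.comp_hasFDerivAt p (pr 0)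
  obtain ⟨D₀, h₀, e₀⟩ : ∃ D : E →L[ℝ] ℝ, HasFDerivAt (fun p : E => T (p 0)) D p ∧
      ∀ w, D w = T' * w 0 := ⟨_, co hT, fun w => by simp⟩
  obtain ⟨D₁, h₁, e₁⟩ : ∃ D : E →L[ℝ] ℝ, HasFDerivAt (fun p : E => a (p 0) * p 1 + X (p 0)) D p ∧
      ∀ w, D w = a' * w 0 * p 1 + a (p 0) * w 1 + X' * w 0 :=
    ⟨_, ((co ha).mul (pr 1)).add (co hX), fun w => by simp; ring⟩
  obtain ⟨D₂, h₂, e₂⟩ : ∃ D : E →L[ℝ] ℝ, HasFDerivAt (fun p : E => a (p 0) * p 2 + Y (p 0)) D p ∧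
      ∀ w, D w = a' * w 0 * p 2 + a (p 0) * w 2 + Y' * w 0 :=
    ⟨_, ((co ha).mul (pr 2)).add (co hY), fun w => by simp; ring⟩
  obtain ⟨D₃, h₃, e₃⟩ : ∃ D : E →L[ℝ] ℝ, HasFDerivAt (fun p : E => A ^ 2 * p 3
      - k (p 0) * (p 1 ^ 3 + p 2 ^ 3) - (m₁ (p 0) * p 1 ^ 2 + m₂ (p 0) * p 2 ^ 2)
      + W₁ (p 0) * p 1 + W₂ (p 0) * p 2 + W₀ (p 0)) D p ∧
      ∀ w, D w = A ^ 2 * w 3 - (k' * w 0 * (p 1 ^ 3 + p 2 ^ 3)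
            + k (p 0) * (3 * p 1 ^ 2 * w 1 + 3 * p 2 ^ 2 * w 2))
          - (m₁' * w 0 * p 1 ^ 2 + 2 * m₁ (p 0) * p 1 * w 1
            + m₂' * w 0 * p 2 ^ 2 + 2 * m₂ (p 0) * p 2 * w 2)
          + (W₁' * w 0 * p 1 + W₁ (p 0) * w 1) + (W₂' * w 0 * p 2 + W₂ (p 0) * w 2)
          + W₀' * w 0 :=
    ⟨_, ((((((pr 3).const_mul (A ^ 2)).sub ((co hk).mul (((pr 1).pow 3).add
      ((pr 2).pow 3)))).sub (((co hm₁).mul ((pr 1).pow 2)).add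
      ((co hm₂).mul ((pr 2).pow 2)))).add ((co hW₁).mul (pr 1))).add
      ((co hW₂).mul (pr 2))).add (co hW₀), fun w => by simp; ring⟩
  obtain ⟨D₄, h₄, e₄⟩ : ∃ D : E →L[ℝ] ℝ, HasFDerivAt (fun p : E => A * p 4 + B) D p ∧
      ∀ w, D w = A * w 4 := ⟨_, ((pr 4).const_mul A).add_const B, fun w => by simp⟩
  refine ⟨ContinuousLinearMap.pi ![D₀, D₁, D₂, D₃, D₄], hasFDerivAt_pi.2 fun i => ?_, ?_⟩
  · fin_cases i
    · exact h₀
    · exact h₁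
    · exact h₂
    · exact h₃
    · exact h₄
  · intro w
    funext i
    fin_cases i
    · simp [e₀]
    · simp [e₁]
    · simp [e₂]
    · simp [e₃]
    · simp [e₄]

theorem isOpen_slab {I : Set ℝ} (hI : IsOpen I) : IsOpen (slab I) :=
  hI.preimage (continuous_apply 0)

/-- A transformation of general shape as a local homeomorphism. -/
noncomputable def genHomeo (S : OpenPartialHomeomorph ℝ ℝ) (a X Y k m₁ m₂ W₀ W₁ W₂ : ℝ → ℝ)
    (A B : ℝ) (hA : A ≠ 0) (ha : ∀ t ∈ S.source, a t ≠ 0) (hac : ContinuousOn a S.source)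
    (hX : ContinuousOn X S.source) (hY : ContinuousOn Y S.source)
    (hk : ContinuousOn k S.source) (hm₁ : ContinuousOn m₁ S.source)
    (hm₂ : ContinuousOn m₂ S.source) (hW₀ : ContinuousOn W₀ S.source)
    (hW₁ : ContinuousOn W₁ S.source) (hW₂ : ContinuousOn W₂ S.source) :
    OpenPartialHomeomorph E E where
  toFun := genMap S a X Y k m₁ m₂ W₀ W₁ W₂ A B
  -- The map is triangular: t is recovered by `S.symm`, then x and y by dividing by `a`, then u from
  -- the known x and y.
  invFun := fun q =>
    ![S.symm (q 0), (q 1 - X (S.symm (q 0))) / a (S.symm (q 0)),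
      (q 2 - Y (S.symm (q 0))) / a (S.symm (q 0)),
      (q 3 + k (S.symm (q 0)) * (((q 1 - X (S.symm (q 0))) / a (S.symm (q 0))) ^ 3
          + ((q 2 - Y (S.symm (q 0))) / a (S.symm (q 0))) ^ 3)
        + (m₁ (S.symm (q 0)) * ((q 1 - X (S.symm (q 0))) / a (S.symm (q 0))) ^ 2
          + m₂ (S.symm (q 0)) * ((q 2 - Y (S.symm (q 0))) / a (S.symm (q 0))) ^ 2)
        - W₁ (S.symm (q 0)) * ((q 1 - X (S.symm (q 0))) / a (S.symm (q 0)))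
        - W₂ (S.symm (q 0)) * ((q 2 - Y (S.symm (q 0))) / a (S.symm (q 0)))
        - W₀ (S.symm (q 0))) / A ^ 2,
      (q 4 - B) / A]
  source := slab S.source
  target := slab S.target
  map_source' p hp := S.map_source hp
  map_target' q hq := S.map_target hq
  left_inv' p hp := by
    have h1 : S.symm (S (p 0)) = p 0 := S.left_inv hp
    have h2 := ha _ hp
    funext i
    fin_cases i
    · simp [genMap, h1]
    · simp [genMap, h1, h2]
    · simp [genMap, h1, h2]
    · simp [genMap, h1, h2]; field_simp; ring
    · simp [genMap, hA]
  right_inv' q hq := by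
    have h1 : S (S.symm (q 0)) = q 0 := S.right_inv hq
    have h2 := ha _ (S.map_target hq)
    funext i
    fin_cases i
    · simp [genMap, h1]
    · simp [genMap, h2, mul_div_cancel₀]
    · simp [genMap, h2, mul_div_cancel₀]
    · simp [genMap, hA, mul_div_cancel₀]; ring
    · simp [genMap, hA, mul_div_cancel₀]
  open_source := isOpen_slab S.open_source
  open_target := isOpen_slab S.open_target
  continuousOn_toFun := by
    have c : ∀ {f : ℝ → ℝ}, ContinuousOn f S.source →
        ContinuousOn (fun p : E => f (p 0)) (slab S.source) := fun hf =>
      hf.comp (continuous_apply 0).continuousOn fun _ h => h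
    have hx : ∀ i, ContinuousOn (fun p : E => p i) (slab S.source) := fun i =>
      (continuous_apply i).continuousOn
    refine continuousOn_pi.2 fun i => ?_
    fin_cases i
    · exact c S.continuousOn
    · exact ((c hac).mul (hx 1)).add (c hX)
    · exact ((c hac).mul (hx 2)).add (c hY)
    · exact ((((((hx 3).const_mul _).sub ((c hk).mul (((hx 1).pow 3).add ((hx 2).pow 3)))).sub
        (((c hm₁).mul ((hx 1).pow 2)).add ((c hm₂).mul ((hx 2).pow 2)))).add
        ((c hW₁).mul (hx 1))).add ((c hW₂).mul (hx 2))).add (c hW₀)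
    · exact ((hx 4).const_mul _).add continuousOn_const
  continuousOn_invFun := by
    have hs : ContinuousOn (fun q : E => S.symm (q 0)) (slab S.target) :=
      S.continuousOn_symm.comp (continuous_apply 0).continuousOn fun _ h => h
    have c : ∀ {f : ℝ → ℝ}, ContinuousOn f S.source →
        ContinuousOn (fun q : E => f (S.symm (q 0))) (slab S.target) := fun hf =>
      hf.comp hs fun _ h => S.map_target h
    have hx : ∀ i, ContinuousOn (fun q : E => q i) (slab S.target) := fun i =>
      (continuous_apply i).continuousOn
    have hne : ∀ q ∈ slab S.target, a (S.symm (q 0)) ≠ 0 := fun q hq => ha _ (S.map_target hq)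
    have h1 := ((hx 1).sub (c hX)).div (c hac) hne
    have h2 := ((hx 2).sub (c hY)).div (c hac) hne
    refine continuousOn_pi.2 fun i => ?_
    fin_cases i
    · exact hs
    · exact h1
    · exact h2
    · exact (((((hx 3).add ((c hk).mul ((h1.pow 3).add (h2.pow 3)))).add
        (((c hm₁).mul (h1.pow 2)).add ((c hm₂).mul (h2.pow 2)))).sub ((c hW₁).mul h1)).sub
        ((c hW₂).mul h2)).sub (c hW₀) |>.div_const _
    · exact ((hx 4).sub continuousOn_const).div_const _

theorem mem_GLax_of_generator {e : OpenPartialHomeomorph E E}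
    (h : IsFormTransformation e ∨ IsSwap e) : e ∈ GLax :=
  Set.mem_iInter₂.2 fun _ hG => hG e h

theorem GLax_le {G : StructureGroupoid E}
    (h : ∀ e, IsFormTransformation e ∨ IsSwap e → e ∈ G) : GLax ≤ G :=
  sInf_le h

/-- `R` is the inverse of `T`. Its smoothness is exported because the parameter functions of a
transformed field are old ones composed with `R`. -/
theorem exists_formMap_homeo {I : Set ℝ} (hI : IsOpenInterval I)
    {T X Y W₀ W₁ W₂ : ℝ → ℝ} {A : ℝ} (B : ℝ) (hA : A ≠ 0) (hT : ContDiffOn ℝ ∞ T I)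
    (hT' : ∀ t ∈ I, deriv T t ≠ 0) (hX : ContDiffOn ℝ ∞ X I) (hY : ContDiffOn ℝ ∞ Y I) (hW₀ : ContDiffOn ℝ ∞ W₀ I)
    (hW₁ : ContDiffOn ℝ ∞ W₁ I) (hW₂ : ContDiffOn ℝ ∞ W₂ I) :
    ∃ (Φ : OpenPartialHomeomorph E E) (J : Set ℝ) (R : ℝ → ℝ), Φ ∈ GLax ∧ IsOpenInterval J ∧
      Φ.source = slab I ∧ Φ.target = slab J ∧ ⇑Φ = formMap T X Y W₀ W₁ W₂ A B ∧
      MapsTo T I J ∧ MapsTo R J I ∧ (∀ t ∈ I, R (T t) = t) ∧ (∀ t ∈ J, T (R t) = t) ∧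
      ContDiffOn ℝ ∞ R J := by
  obtain ⟨S, rfl, rfl, hJ, hR⟩ := exists_openPartialHomeomorph hI hT hT'
  have ho := S.open_source
  have cA := cbrt_ne_zero hA
  have hT1 := contDiffOn_deriv ho hT
  have hT2 := contDiffOn_deriv ho hT1
  have hc : ContinuousOn (fun t => cbrt (deriv S t)) S.source := fun t ht =>
    ((contDiffAt_cbrt (hT' t ht)).continuousAt).comp_continuousWithinAt
      (hT1.continuousOn t ht)
  have hc0 : ∀ t ∈ S.source, cbrt (deriv S t) ≠ 0 := fun t ht => cbrt_ne_zero (hT' t ht)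
  have hm : ContinuousOn (fun t => cbrt A ^ 4 / (2 * cbrt (deriv S t))) S.source :=
    continuousOn_const.div (hc.const_mul 2) fun t ht => mul_ne_zero two_ne_zero (hc0 t ht)
  let Φ := genHomeo S (fun t => cbrt A ^ 2 * cbrt (deriv S t)) X Y
      (fun t => A ^ 2 * deriv (deriv S) t / (18 * deriv S t))
      (fun t => cbrt A ^ 4 / (2 * cbrt (deriv S t)) * deriv X t)
      (fun t => cbrt A ^ 4 / (2 * cbrt (deriv S t)) * deriv Y t) W₀ W₁ W₂ A B hA
      (fun t ht => mul_ne_zero (pow_ne_zero 2 cA) (hc0 t ht)) (hc.const_mul _)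
      hX.continuousOn hY.continuousOn
      ((hT2.continuousOn.const_mul _).div (hT1.continuousOn.const_mul _)
        fun t ht => mul_ne_zero (by norm_num) (hT' t ht))
      (hm.mul (contDiffOn_deriv ho hX).continuousOn)
      (hm.mul (contDiffOn_deriv ho hY).continuousOn)
      hW₀.continuousOn hW₁.continuousOn hW₂.continuousOn
  have hΦ : ⇑Φ = formMap S X Y W₀ W₁ W₂ A B := by
    rw [formMap_eq_genMap]; rfl
  refine ⟨Φ, S.target, S.symm, mem_GLax_of_generator (Or.inl ?_), hJ, rfl, rfl, hΦ,
    S.mapsTo, S.mapsTo_symm, fun t ht => S.left_inv ht, fun t ht => S.right_inv ht, hR⟩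
  exact ⟨S.source, S, X, Y, W₀, W₁, W₂, A, B, hI, hT, hX, hY, hW₀, hW₁, hW₂, hT', hA, rfl,
    fun p _ => congrFun hΦ p⟩

/-- The derivatives of the composite coefficients are left abstract; each application identifies
them, as far as it needs them, by uniqueness of derivatives. -/
theorem hasFDerivAt_formMap {I : Set ℝ} (ho : IsOpen I) {T X Y W₀ W₁ W₂ : ℝ → ℝ} (A B : ℝ)
    (hT : ContDiffOn ℝ ∞ T I) (hT' : ∀ t ∈ I, deriv T t ≠ 0)
    (hX : ContDiffOn ℝ ∞ X I) (hY : ContDiffOn ℝ ∞ Y I) (hW₀ : ContDiffOn ℝ ∞ W₀ I)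
    (hW₁ : ContDiffOn ℝ ∞ W₁ I) (hW₂ : ContDiffOn ℝ ∞ W₂ I) {p : E} (hp : p ∈ slab I) :
    ∃ (g' k' m₁' m₂' : ℝ) (D : E →L[ℝ] E), HasFDerivAt (formMap T X Y W₀ W₁ W₂ A B) D p ∧
      HasDerivAt (fun t => cbrt (deriv T t)) g' (p 0) ∧
      HasDerivAt (fun t => A ^ 2 * deriv (deriv T) t / (18 * deriv T t)) k' (p 0) ∧
      HasDerivAt (fun t => cbrt A ^ 4 / (2 * cbrt (deriv T t)) * deriv X t) m₁' (p 0) ∧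
      HasDerivAt (fun t => cbrt A ^ 4 / (2 * cbrt (deriv T t)) * deriv Y t) m₂' (p 0) ∧
      ∀ w : E, D w = ![deriv T (p 0) * w 0,
        cbrt A ^ 2 * g' * w 0 * p 1 + cbrt A ^ 2 * cbrt (deriv T (p 0)) * w 1
          + deriv X (p 0) * w 0,
        cbrt A ^ 2 * g' * w 0 * p 2 + cbrt A ^ 2 * cbrt (deriv T (p 0)) * w 2
          + deriv Y (p 0) * w 0,
        A ^ 2 * w 3 - (k' * w 0 * (p 1 ^ 3 + p 2 ^ 3)
            + A ^ 2 * deriv (deriv T) (p 0) / (18 * deriv T (p 0))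
              * (3 * p 1 ^ 2 * w 1 + 3 * p 2 ^ 2 * w 2))
          - (m₁' * w 0 * p 1 ^ 2
            + 2 * (cbrt A ^ 4 / (2 * cbrt (deriv T (p 0))) * deriv X (p 0)) * p 1 * w 1
            + m₂' * w 0 * p 2 ^ 2
            + 2 * (cbrt A ^ 4 / (2 * cbrt (deriv T (p 0))) * deriv Y (p 0)) * p 2 * w 2)
          + (deriv W₁ (p 0) * w 0 * p 1 + W₁ (p 0) * w 1)
          + (deriv W₂ (p 0) * w 0 * p 2 + W₂ (p 0) * w 2) + deriv W₀ (p 0) * w 0,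
        A * w 4] := by
  have hT1 := contDiffOn_deriv ho hT
  have hT2 := contDiffOn_deriv ho hT1
  have hd : ∀ {f : ℝ → ℝ}, ContDiffOn ℝ ∞ f I → HasDerivAt f (deriv f (p 0)) (p 0) :=
    fun hf => hasDerivAt_of_contDiffOn ho hf hp
  have hg := ((contDiffAt_cbrt (hT' _ hp)).differentiableAt (by simp)).hasDerivAt.comp (p 0)
    (hd hT1)
  have hm := (hasDerivAt_const (p 0) (cbrt A ^ 4)).div (hg.const_mul 2)
    (mul_ne_zero two_ne_zero (cbrt_ne_zero (hT' _ hp)))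
  have hk := ((hd hT2).const_mul (A ^ 2)).div ((hd hT1).const_mul 18)
    (mul_ne_zero (by norm_num) (hT' _ hp))
  have h₁ := hm.mul (hd (contDiffOn_deriv ho hX))
  have h₂ := hm.mul (hd (contDiffOn_deriv ho hY))
  obtain ⟨D, hD, hw⟩ := hasFDerivAt_genMap A B (hd hT) (hg.const_mul (cbrt A ^ 2)) (hd hX)
    (hd hY) hk h₁ h₂ (hd hW₀) (hd hW₁) (hd hW₂)
  refine ⟨_, _, _, _, D, ?_, hg, hk, h₁, h₂, hw⟩
  rw [formMap_eq_genMap]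
  exact hD

/-! ### The infinitesimal shape of the elements of the pseudogroup -/

/-- The triangular form of the derivatives of the elements of the pseudogroup. -/
def Shape (A : ℝ) (D : E →L[ℝ] E) : Prop :=
  (∃ c : ℝ, c ≠ 0 ∧ ∀ w, D w 0 = c * w 0) ∧
  (∃ c : ℝ, c ≠ 0 ∧ ((∀ w, w 0 = 0 → D w 1 = c * w 1 ∧ D w 2 = c * w 2) ∨
    ∀ w, w 0 = 0 → D w 1 = c * w 2 ∧ D w 2 = c * w 1)) ∧
  (∀ w, w 0 = 0 → w 1 = 0 → w 2 = 0 → D w 3 = A ^ 2 * w 3) ∧ ∀ w, D w 4 = A * w 4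

theorem Shape.xy_eq_zero {A : ℝ} {D : E →L[ℝ] E} (h : Shape A D) {w : E} (h0 : w 0 = 0)
    (h1 : w 1 = 0) (h2 : w 2 = 0) : D w 0 = 0 ∧ D w 1 = 0 ∧ D w 2 = 0 := by
  obtain ⟨⟨c, -, hc⟩, ⟨b, -, hb | hb⟩, -, -⟩ := h <;> simp [hc, hb w h0, h0, h1, h2]

theorem Shape.comp {A A' : ℝ} {D D' : E →L[ℝ] E} (h : Shape A D) (h' : Shape A' D') :
    Shape (A' * A) (D'.comp D) := by
  have hz := fun w h0 h1 h2 => h.xy_eq_zero (w := w) h0 h1 h2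
  obtain ⟨⟨c, c0, hc⟩, ⟨b, b0, hb⟩, h3, h4⟩ := h
  obtain ⟨⟨c', c0', hc'⟩, ⟨b', b0', hb'⟩, h3', h4'⟩ := h'
  refine ⟨⟨c' * c, mul_ne_zero c0' c0, fun w => ?_⟩, ⟨b' * b, mul_ne_zero b0' b0, ?_⟩,
    fun w h0 h1 h2 => ?_, fun w => ?_⟩
  · simp [hc, hc', mul_assoc]
  · have key : ∀ w : E, w 0 = 0 → D w 0 = 0 := fun w hw => by simp [hc, hw]
    rcases hb with hb | hb <;> rcases hb' with hb' | hb'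
    · left; intro w hw; simp [hb w hw, hb' _ (key w hw), mul_assoc]
    · right; intro w hw; simp [hb w hw, hb' _ (key w hw), mul_assoc]
    · right; intro w hw; simp [hb w hw, hb' _ (key w hw), mul_assoc]
    · left; intro w hw; simp [hb w hw, hb' _ (key w hw), mul_assoc]
  · obtain ⟨z0, z1, z2⟩ := hz w h0 h1 h2
    simp only [ContinuousLinearMap.comp_apply]
    rw [h3' _ z0 z1 z2, h3 w h0 h1 h2]; ring
  · simp [h4, h4', mul_assoc]

/-- A triangular endomorphism with nonzero diagonal blocks has trivial kernel, which suffices in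
finite dimension. -/
theorem Shape.exists_equiv {A : ℝ} {D : E →L[ℝ] E} (hA : A ≠ 0) (h : Shape A D) :
    ∃ D' : E ≃L[ℝ] E, (D' : E →L[ℝ] E) = D := by
  obtain ⟨⟨c, c0, hc⟩, ⟨b, b0, hb⟩, h3, h4⟩ := h
  have hinj : Function.Injective D.toLinearMap := by
    rw [injective_iff_map_eq_zero]
    intro w hw
    have hw : D w = 0 := hw
    have w0 : w 0 = 0 := by simpa [hw, c0] using hc w
    have w4 : w 4 = 0 := by simpa [hw, hA] using h4 w
    have w12 : w 1 = 0 ∧ w 2 = 0 := by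
      rcases hb with hb | hb
      · simpa [hw, b0] using hb w w0
      · simpa [hw, b0, and_comm] using hb w w0
    have w3 : w 3 = 0 := by simpa [hw, hA] using h3 w w0 w12.1 w12.2
    funext i
    fin_cases i
    · exact w0
    · exact w12.1
    · exact w12.2
    · exact w3
    · exact w4
  refine ⟨(LinearEquiv.ofInjectiveEndo D.toLinearMap hinj).toContinuousLinearEquiv, ?_⟩
  ext w i
  rfl

theorem Shape.symm {A : ℝ} {D : E ≃L[ℝ] E} (hA : A ≠ 0) (h : Shape A (D : E →L[ℝ] E)) :
    Shape A⁻¹ (D.symm : E →L[ℝ] E) := by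
  obtain ⟨⟨c, c0, hc⟩, ⟨b, b0, hb⟩, h3, h4⟩ := h
  have z0 : ∀ w : E, D.symm w 0 = c⁻¹ * w 0 := fun w => by
    have := hc (D.symm w)
    simp only [ContinuousLinearEquiv.coe_coe, ContinuousLinearEquiv.apply_symm_apply] at this
    rw [this]; field_simp
  have hb2 : (∀ w : E, w 0 = 0 → D.symm w 1 = b⁻¹ * w 1 ∧ D.symm w 2 = b⁻¹ * w 2) ∨
      ∀ w : E, w 0 = 0 → D.symm w 1 = b⁻¹ * w 2 ∧ D.symm w 2 = b⁻¹ * w 1 := by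
    refine hb.imp (fun hb w hw => ?_) (fun hb w hw => ?_)
    all_goals
      have := hb (D.symm w) (by simp [z0, hw])
      simp only [ContinuousLinearEquiv.coe_coe, ContinuousLinearEquiv.apply_symm_apply] at this
      rw [this.1, this.2]
      constructor <;> field_simp
  refine ⟨⟨c⁻¹, inv_ne_zero c0, z0⟩, ⟨b⁻¹, inv_ne_zero b0, hb2⟩, fun w h0 h1 h2 => ?_,
    fun w => ?_⟩
  · have h12 : D.symm w 1 = 0 ∧ D.symm w 2 = 0 := by
      rcases hb2 with hb | hb <;> simp [hb w h0, h1, h2]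
    have := h3 (D.symm w) (by simp [z0, h0]) h12.1 h12.2
    simp only [ContinuousLinearEquiv.coe_coe, ContinuousLinearEquiv.apply_symm_apply] at this ⊢
    rw [this]; field_simp
  · have := h4 (D.symm w)
    simp only [ContinuousLinearEquiv.coe_coe, ContinuousLinearEquiv.apply_symm_apply] at this ⊢
    rw [this]; field_simp

/-- A map is locally shaped on `s` if near each point of `s` its derivatives are of triangular
form with a constant factor `A`. -/
def LocallyShaped (f : E → E) (s : Set E) : Prop :=
  ∀ p ∈ s, ∃ A : ℝ, A ≠ 0 ∧ ∀ᶠ q in 𝓝 p, ∃ D : E →L[ℝ] E, HasFDerivAt f D q ∧ Shape A D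

theorem LocallyShaped.congr {f g : E → E} {u : Set E} (hu : IsOpen u)
    (h : ∀ x ∈ u, g x = f x) (hf : LocallyShaped f u) : LocallyShaped g u := fun p hp => by
  obtain ⟨A, hA, h1⟩ := hf p hp
  refine ⟨A, hA, ?_⟩
  filter_upwards [h1, hu.mem_nhds hp] with q ⟨D, hD, hs⟩ hq
  exact ⟨D, hD.congr_of_eventuallyEq (eventuallyEq_of_mem (hu.mem_nhds hq) h), hs⟩

/-- The pregroupoid of locally shaped maps. -/
def shapePregroupoid : Pregroupoid E where
  property := LocallyShaped
  comp := by
    intro f g u v hf hg _ _ _ p hp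
    obtain ⟨A, hA, h1⟩ := hf p hp.1
    obtain ⟨A', hA', h2⟩ := hg (f p) hp.2
    obtain ⟨D₀, hD₀, -⟩ := h1.self_of_nhds
    refine ⟨A' * A, mul_ne_zero hA' hA, ?_⟩
    filter_upwards [h1, hD₀.continuousAt.eventually h2] with q ⟨D, hD, hs⟩ ⟨D', hD', hs'⟩
    exact ⟨D'.comp D, hD'.comp q hD, hs.comp hs'⟩
  id_mem := fun p _ => ⟨1, one_ne_zero, Eventually.of_forall fun q =>
    ⟨ContinuousLinearMap.id ℝ E, hasFDerivAt_id q, ⟨1, one_ne_zero, by simp⟩,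
      ⟨1, one_ne_zero, by simp⟩, by simp, by simp⟩⟩
  locality := by
    intro f u _ h p hp
    obtain ⟨v, _, hv, hf⟩ := h p hp
    exact hf p ⟨hp, hv⟩
  congr := fun hu h hf => hf.congr hu h

/-- The groupoid of a pregroupoid asks for the property of both a map and its inverse; here the
second follows from the first because the derivatives are invertible. -/
theorem LocallyShaped.symm {e : OpenPartialHomeomorph E E} (h : LocallyShaped e e.source) :
    LocallyShaped e.symm e.target := fun q hq => by
  obtain ⟨A, hA, h1⟩ := h _ (e.map_target hq)
  refine ⟨A⁻¹, inv_ne_zero hA, ?_⟩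
  filter_upwards [(e.continuousAt_symm hq).eventually h1, e.open_target.mem_nhds hq]
    with r ⟨D, hD, hs⟩ hr
  obtain ⟨D', rfl⟩ := hs.exists_equiv hA
  exact ⟨_, e.hasFDerivAt_symm hr hD, hs.symm hA⟩

theorem locallyShaped_of_form {e : OpenPartialHomeomorph E E} (h : IsFormTransformation e) :
    LocallyShaped e e.source := by
  obtain ⟨I, T, X, Y, W₀, W₁, W₂, A, B, hI, hT, hX, hY, hW₀, hW₁, hW₂, hT', hA, hs, he⟩ := h
  refine LocallyShaped.congr e.open_source (f := formMap T X Y W₀ W₁ W₂ A B)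
    (fun p hp => he p (hs ▸ hp)) fun p hp => ⟨A, hA, ?_⟩
  filter_upwards [e.open_source.mem_nhds hp] with q hq
  rw [hs] at hq
  obtain ⟨g', k', m₁', m₂', D, hD, -, -, -, -, hw⟩ :=
    hasFDerivAt_formMap hI.2.1 A B hT hT' hX hY hW₀ hW₁ hW₂ hq
  refine ⟨D, hD, ⟨_, hT' _ hq, fun w => by simp [hw]⟩, ⟨cbrt A ^ 2 * cbrt (deriv T (q 0)),
    mul_ne_zero (pow_ne_zero 2 (cbrt_ne_zero hA)) (cbrt_ne_zero (hT' _ hq)), Or.inl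
    fun w h0 => by simp [hw, h0]⟩, fun w h0 h1 h2 => by simp [hw, h0, h1, h2],
    fun w => by simp [hw]⟩

/-- The permutation of `x` and `y` as a linear map. -/
def swapL : E →L[ℝ] E :=
  ContinuousLinearMap.pi fun i => ContinuousLinearMap.proj (![0, 2, 1, 3, 4] i)

theorem swapL_apply (p : E) : swapL p = ![p 0, p 2, p 1, p 3, p 4] := by
  funext i
  fin_cases i <;> rfl

theorem locallyShaped_of_swap {e : OpenPartialHomeomorph E E} (h : IsSwap e) :
    LocallyShaped e e.source := by
  refine LocallyShaped.congr e.open_source (f := swapL)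
    (fun p _ => by rw [h.2, swapL_apply]) fun p hp => ⟨1, one_ne_zero, ?_⟩
  refine Eventually.of_forall fun q => ⟨swapL, swapL.hasFDerivAt, ⟨1, one_ne_zero, ?_⟩,
    ⟨1, one_ne_zero, Or.inr ?_⟩, ?_, ?_⟩ <;> simp [swapL_apply]

/-- The locally shaped maps form a groupoid containing the generators, hence containing the smallest
one. In particular every element of the pseudogroup is differentiable. -/
theorem locallyShaped_of_mem_GLax {Φ : OpenPartialHomeomorph E E} (h : Φ ∈ GLax) :
    LocallyShaped Φ Φ.source := by
  have hle : GLax ≤ shapePregroupoid.groupoid := GLax_le fun e he => by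
    have : LocallyShaped e e.source := he.elim locallyShaped_of_form locallyShaped_of_swap
    exact mem_groupoid_of_pregroupoid.2 ⟨this, this.symm⟩
  exact (mem_groupoid_of_pregroupoid.1 (StructureGroupoid.le_iff.1 hle Φ h)).1

/-! ### Invariants of lines of vector fields -/

theorem ext_apply {I : Set ℝ} (Q : VF I) (p : slab I) : Q.ext p.1 = Q p :=
  Subtype.val_injective.extend_apply Q 0 p

/-- The vector fields `G` on `I × ℝ⁴` and `G'` on `J × ℝ⁴` span lines related by a
locally shaped homeomorphism. -/
def LineRel (I J : Set ℝ) (G G' : E → E) : Prop :=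
  ∃ Φ : OpenPartialHomeomorph E E, Φ.source = slab I ∧ Φ.target = slab J ∧
    LocallyShaped Φ (slab I) ∧ LocallyShaped Φ.symm (slab J) ∧
    ∃ l : ℝ, l ≠ 0 ∧ ∀ p ∈ slab I, ∀ D : E →L[ℝ] E, HasFDerivAt Φ D p → D (G p) = l • G' (Φ p)

theorem LineRel.symm {I J : Set ℝ} {G G' : E → E} (h : LineRel I J G G') :
    LineRel J I G' G := by
  obtain ⟨Φ, hs, ht, h1, h2, l, hl, h⟩ := h
  refine ⟨Φ.symm, ht, hs, h2, h1, l⁻¹, inv_ne_zero hl, fun q hq D hD => ?_⟩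
  have hq' : q ∈ Φ.target := ht ▸ hq
  have hp : Φ.symm q ∈ Φ.source := Φ.map_target hq'
  obtain ⟨A, hA, hev⟩ := h1 _ (hs ▸ hp)
  obtain ⟨D', hD', -⟩ := hev.self_of_nhds
  have hD2 : HasFDerivAt Φ.symm D (Φ (Φ.symm q)) := by rwa [Φ.right_inv hq']
  -- Chain rule for `Φ.symm ∘ Φ`, which is the identity near the point.
  have hid : D.comp D' = ContinuousLinearMap.id ℝ E := by
    refine (hD2.comp _ hD').unique ((hasFDerivAt_id _).congr_of_eventuallyEq ?_)
    filter_upwards [Φ.eventually_left_inverse hp] with x hx using hx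
  have := h _ (hs ▸ hp) D' hD'
  rw [Φ.right_inv hq'] at this
  rw [eq_inv_smul_iff₀ hl, ← map_smul, ← this]
  exact congrArg (fun L : E →L[ℝ] E => L (G (Φ.symm q))) hid

theorem LineRel.exists_shape {I J : Set ℝ} {G G' : E → E} (h : LineRel I J G G') {q : E}
    (hq : q ∈ slab J) : ∃ p ∈ slab I, ∃ (A c : ℝ) (D : E →L[ℝ] E), A ≠ 0 ∧ c ≠ 0 ∧
      Shape A D ∧ G' q = c • D (G p) := by
  obtain ⟨Φ, hs, ht, h1, -, l, hl, h⟩ := h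
  have hq' : q ∈ Φ.target := ht ▸ hq
  have hp : Φ.symm q ∈ slab I := hs ▸ Φ.map_target hq'
  obtain ⟨A, hA, hev⟩ := h1 _ hp
  obtain ⟨D, hD, hsh⟩ := hev.self_of_nhds
  refine ⟨_, hp, A, l⁻¹, D, hA, inv_ne_zero hl, hsh, ?_⟩
  rw [h _ hp D hD, Φ.right_inv hq', inv_smul_smul₀ hl]

/-- The components with respect to `∂_t`, `∂_x` and `∂_y` vanish. -/
def Vertical (I : Set ℝ) (G : E → E) : Prop :=
  ∀ p ∈ slab I, G p 0 = 0 ∧ G p 1 = 0 ∧ G p 2 = 0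

theorem LineRel.vertical {I J : Set ℝ} {G G' : E → E} (h : LineRel I J G G')
    (hG : Vertical I G) : Vertical J G' := fun q hq => by
  obtain ⟨p, hp, A, c, D, -, -, hD, hq'⟩ := h.exists_shape hq
  obtain ⟨h0, h1, h2⟩ := hG p hp
  obtain ⟨z0, z1, z2⟩ := hD.xy_eq_zero h0 h1 h2
  simp [hq', z0, z1, z2]

/-- For vertical fields the u-component is transported with the factor `l⁻¹ * A ^ 2`, so its
differential is a multiple of the old one composed with a shaped map. This makes conditions on that
differential invariant. -/
theorem LineRel.hasFDerivAt {I J : Set ℝ} (hJ : IsOpen J) {G G' : E → E}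
    (h : LineRel I J G G') (hG : Vertical I G) {q : E} (hq : q ∈ slab J) :
    ∃ p ∈ slab I, ∀ L : E →L[ℝ] ℝ, HasFDerivAt (fun p => G p 3) L p →
      ∃ (A c : ℝ) (D : E →L[ℝ] E), Shape A D ∧
        HasFDerivAt (fun q => G' q 3) (c • L.comp D) q := by
  obtain ⟨Φ, hs, ht, h1, h2, l, hl, h⟩ := h
  have hq' : q ∈ Φ.target := ht ▸ hq
  have hp : Φ.symm q ∈ slab I := hs ▸ Φ.map_target hq'
  obtain ⟨A, hA, hev⟩ := h1 _ hp
  obtain ⟨B, hB, hev'⟩ := h2 q hq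
  obtain ⟨D, hD, hsh⟩ := hev'.self_of_nhds
  refine ⟨_, hp, fun L hL => ⟨B, l⁻¹ * A ^ 2, D, hsh, ?_⟩⟩
  -- Here local constancy of `A` matters: the transport formula holds near `q` with one and the same
  -- factor, so no derivative of `A` appears.
  refine ((hL.comp q hD).const_mul (l⁻¹ * A ^ 2)).congr_of_eventuallyEq ?_
  filter_upwards [(Φ.continuousAt_symm hq').eventually hev, (isOpen_slab hJ).mem_nhds hq]
    with r ⟨D', hD', hsh'⟩ hr
  have hr' : r ∈ Φ.target := ht ▸ hr
  have hpr : Φ.symm r ∈ slab I := hs ▸ Φ.map_target hr'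
  have e1 := h _ hpr D' hD'
  obtain ⟨v0, v1, v2⟩ := hG _ hpr
  have e2 := hsh'.2.2.1 _ v0 v1 v2
  rw [e1, Φ.right_inv hr'] at e2
  simp only [Pi.smul_apply, smul_eq_mul] at e2
  simp only [Function.comp]
  rw [mul_assoc, ← e2]; field_simp

/-- A descending chain of properties invariant under the pseudogroup. -/
def Level (I : Set ℝ) (G : E → E) : ℕ → Prop
  | 0 => True
  | 1 => ∀ p ∈ slab I, G p 0 = 0
  | 2 => ∀ p ∈ slab I, G p 0 = 0 ∧ (G p 1 = 0 ∨ G p 2 = 0)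
  | 3 => Vertical I G
  | 4 => Vertical I G ∧ ∀ p ∈ slab I, ∃ L : E →L[ℝ] ℝ, HasFDerivAt (fun p => G p 3) L p ∧
      ∀ w, w 0 = 0 → L w = 0
  | 5 => Vertical I G ∧ ∀ p ∈ slab I, HasFDerivAt (fun p => G p 3) (0 : E →L[ℝ] ℝ) p
  | 6 => Vertical I G ∧ ∀ p ∈ slab I, G p 3 = 0
  | _ => False

theorem Level.of_succ {I : Set ℝ} (hI : IsOpen I) {G : E → E} {n : ℕ} (h : Level I G (n + 1)) :
    Level I G n := by
  match n, h with
  | 0, _ => trivial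
  | 1, h => exact fun p hp => (h p hp).1
  | 2, h => exact fun p hp => ⟨(h p hp).1, Or.inl (h p hp).2.1⟩
  | 3, h => exact h.1
  | 4, h => exact ⟨h.1, fun p hp => ⟨0, h.2 p hp, by simp⟩⟩
  | 5, h => exact ⟨h.1, fun p hp => (hasFDerivAt_const (0 : ℝ) p).congr_of_eventuallyEq
      (eventuallyEq_of_mem ((isOpen_slab hI).mem_nhds hp) h.2)⟩
  | 6, h => exact h.elim
  | n + 7, h => exact h.elim

theorem Level.mono {I : Set ℝ} (hI : IsOpen I) {G : E → E} {m n : ℕ} (hmn : m ≤ n)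
    (h : Level I G n) : Level I G m := by
  induction hmn with
  | refl => exact h
  | step _ ih => exact ih (h.of_succ hI)

/-- Each condition is read off from the triangular shape. The disjunction at level 2 absorbs the
exchange of x and y; level 4 survives because shaped maps preserve the hyperplane `w 0 = 0`. -/
theorem LineRel.level {I J : Set ℝ} (hJ : IsOpen J) {G G' : E → E}
    (h : LineRel I J G G') {n : ℕ} (hn : Level I G n) : Level J G' n := by
  match n, hn with
  | 0, _ => trivial
  | 1, hn =>
    intro q hq
    obtain ⟨p, hp, A, c, D, -, -, ⟨⟨b, -, hb⟩, -⟩, hq'⟩ := h.exists_shape hq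
    simp [hq', hb, hn p hp]
  | 2, hn =>
    intro q hq
    obtain ⟨p, hp, A, c, D, -, -, ⟨⟨b, -, hb⟩, ⟨a, -, ha⟩, -⟩, hq'⟩ := h.exists_shape hq
    obtain ⟨h0, h12⟩ := hn p hp
    refine ⟨by simp [hq', hb, h0], ?_⟩
    rcases ha with ha | ha <;> rcases h12 with h12 | h12 <;> simp [hq', ha _ h0, h12]
  | 3, hn => exact h.vertical hn
  | 4, hn =>
    refine ⟨h.vertical hn.1, fun q hq => ?_⟩
    obtain ⟨p, hp, hL⟩ := h.hasFDerivAt hJ hn.1 hq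
    obtain ⟨L, hL1, hL2⟩ := hn.2 p hp
    obtain ⟨A, c, D, ⟨⟨b, -, hb⟩, -⟩, hd⟩ := hL L hL1
    exact ⟨_, hd, fun w hw => by simp [hL2 (D w) (by simp [hb, hw])]⟩
  | 5, hn =>
    refine ⟨h.vertical hn.1, fun q hq => ?_⟩
    obtain ⟨p, hp, hL⟩ := h.hasFDerivAt hJ hn.1 hq
    obtain ⟨A, c, D, -, hd⟩ := hL 0 (hn.2 p hp)
    simpa using hd
  | 6, hn =>
    refine ⟨h.vertical hn.1, fun q hq => ?_⟩
    obtain ⟨p, hp, A, c, D, -, -, ⟨-, -, h3, -⟩, hq'⟩ := h.exists_shape hq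
    obtain ⟨v0, v1, v2⟩ := hn.1 p hp
    simp [hq', h3 _ v0 v1 v2, hn.2 p hp]
  | n + 7, hn => exact hn.elim

theorem LineRel.v_eq_zero {I J : Set ℝ} {G G' : E → E} (h : LineRel I J G G')
    (hG : ∀ p ∈ slab I, G p 4 = 0) : ∀ q ∈ slab J, G' q 4 = 0 := fun q hq => by
  obtain ⟨p, hp, A, c, D, -, -, ⟨-, -, -, h4⟩, hq'⟩ := h.exists_shape hq
  simp [hq', h4, hG p hp]

theorem LineRel.v_ne_zero {I J : Set ℝ} {G G' : E → E} (h : LineRel I J G G')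
    (hG : ∀ p ∈ slab I, G p 4 ≠ 0) : ∀ q ∈ slab J, G' q 4 ≠ 0 := fun q hq => by
  obtain ⟨p, hp, A, c, D, hA, hc, ⟨-, -, -, h4⟩, hq'⟩ := h.exists_shape hq
  simp [hq', h4, hG p hp, hA, hc]

theorem pushforward_smul (Φ : OpenPartialHomeomorph E E) {I J : Set ℝ} (h : Φ.source = slab I)
    (h' : Φ.target = slab J) (c : ℝ) (Q : VF I) :
    pushforward Φ J (c • Q) = c • pushforward Φ J Q := by
  funext q
  have hp : Φ.symm q.1 ∈ slab I := h ▸ Φ.map_target (h'.symm ▸ q.2)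
  simp only [pushforward, Pi.smul_apply]
  rw [ext_apply (c • Q) ⟨_, hp⟩, ext_apply Q ⟨_, hp⟩, Pi.smul_apply, map_smul]

/-- The pushforward of the spanning field is a multiple `l` of the other one. If `l` were zero, the
image of the line would be zero, contrary to `hG'`. -/
theorem GLEquivalent.lineRel {I J : Set ℝ} {G G' : E → E} (hG' : ∃ p ∈ slab J, G' p ≠ 0)
    (h : GLEquivalent (Submodule.span ℝ {(fun p => G p.1 : VF I)})
      (Submodule.span ℝ {(fun p => G' p.1 : VF J)})) : LineRel I J G G' := by
  obtain ⟨Φ, hΦ, hs, ht, himg⟩ := h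
  have h1 := locallyShaped_of_mem_GLax hΦ
  have h2 := h1.symm
  rw [hs] at h1
  rw [ht] at h2
  have hmem : pushforward Φ J (fun p => G p.1 : VF I) ∈
      (Submodule.span ℝ {(fun p => G' p.1 : VF J)} : Set (VF J)) :=
    himg ▸ ⟨_, Submodule.mem_span_singleton_self _, rfl⟩
  obtain ⟨l, hl⟩ := Submodule.mem_span_singleton.1 hmem
  have hmem' : (fun p => G' p.1 : VF J) ∈
      pushforward Φ J '' (Submodule.span ℝ {(fun p => G p.1 : VF I)} : Set (VF I)) :=
    himg ▸ Submodule.mem_span_singleton_self _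
  obtain ⟨R, hR, hR'⟩ := hmem'
  obtain ⟨m, rfl⟩ := Submodule.mem_span_singleton.1 hR
  rw [pushforward_smul Φ hs ht, ← hl] at hR'
  refine ⟨Φ, hs, ht, h1, h2, l, ?_, fun p hp D hD => ?_⟩
  · rintro rfl
    obtain ⟨p, hp, hne⟩ := hG'
    exact hne (by simpa using (congrFun hR' ⟨p, hp⟩).symm)
  · have hps : p ∈ Φ.source := hs ▸ hp
    have hq : Φ p ∈ slab J := ht ▸ Φ.map_source hps
    have := congrFun hl ⟨Φ p, hq⟩
    simp only [pushforward, Φ.left_inv hps, Pi.smul_apply] at this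
    rw [this, hD.fderiv, ext_apply _ ⟨p, hp⟩]

/-! ### The members of the list -/

/-- The position of a family in the chain of invariant properties. -/
def Family.level : Family → ℕ
  | .s1 _ _ => 0
  | .s2 => 1
  | .s3 _ => 1
  | .s4 _ => 2
  | .s5 _ => 3
  | .s6 _ => 4
  | .s7 _ => 5
  | .s8 => 6

/-- The value of the `∂_v`-component at `v` for the basis field of a member of a family. -/
noncomputable def Family.vcomp : Family → ℝ → ℝ
  | .s1 δ δ' => fun v => 3 / 2 * δ * v + δ'
  | .s2 => fun v => 3 / 2 * v
  | .s3 δ => fun _ => δ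
  | .s4 δ => fun _ => δ
  | .s5 δ => fun _ => δ
  | .s6 δ => fun _ => δ
  | .s7 δ => fun _ => δ
  | .s8 => fun _ => 1

/-- The point with the given coordinates. -/
def pt (t x y u v : ℝ) : E := ![t, x, y, u, v]

theorem pt_mem {I : Set ℝ} {t : ℝ} (ht : t ∈ I) (x y u v : ℝ) : pt t x y u v ∈ slab I := ht

/-- A line spanned by a vector field of the algebra, with the level and the `∂_v`-component
of the family `F`. -/
def Represents (I : Set ℝ) (F : Family) (s : Submodule ℝ (VF I)) (G : E → E) : Prop :=
  s = Submodule.span ℝ {(fun p => G p.1 : VF I)} ∧ (fun p => G p.1 : VF I) ∈ gL I ∧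
    (∃ p ∈ slab I, G p ≠ 0) ∧ Level I G F.level ∧ ¬ Level I G (F.level + 1) ∧
    ∀ p ∈ slab I, G p 4 = F.vcomp (p 4)

section Membership

variable {I : Set ℝ} {f : ℝ → ℝ}

theorem Dt_mem (hf : ContDiffOn ℝ ∞ f I) : Dt I f ∈ gL I :=
  Submodule.subset_span (by
    iterate 7 left
    exact ⟨f, hf, rfl⟩)

theorem Ds_mem : Ds I ∈ gL I :=
  Submodule.subset_span (by
    iterate 6 left
    right; rfl)

theorem Px_mem (hf : ContDiffOn ℝ ∞ f I) : Px I f ∈ gL I :=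
  Submodule.subset_span (by
    iterate 5 left
    exact Or.inr ⟨f, hf, rfl⟩)

theorem Py_mem (hf : ContDiffOn ℝ ∞ f I) : Py I f ∈ gL I :=
  Submodule.subset_span (by
    iterate 4 left
    exact Or.inr ⟨f, hf, rfl⟩)

theorem Rx_mem (hf : ContDiffOn ℝ ∞ f I) : Rx I f ∈ gL I :=
  Submodule.subset_span (by
    iterate 3 left
    exact Or.inr ⟨f, hf, rfl⟩)

theorem Ry_mem (hf : ContDiffOn ℝ ∞ f I) : Ry I f ∈ gL I :=
  Submodule.subset_span (by
    iterate 2 left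
    exact Or.inr ⟨f, hf, rfl⟩)

theorem Z_mem (hf : ContDiffOn ℝ ∞ f I) : Z I f ∈ gL I :=
  Submodule.subset_span (by
    left
    exact Or.inr ⟨f, hf, rfl⟩)

theorem Pv_mem : Pv I ∈ gL I := Submodule.subset_span (Or.inr rfl)

end Membership

/-- The data on which statements (i) and (iii) depend: a nonzero spanning field of the algebra, its
exact level and its v-component. -/
theorem IsListed.exists_represents {I : Set ℝ} (hI : IsOpenInterval I) {F : Family}
    {s : Submodule ℝ (VF I)} (h : IsListed I F s) : ∃ G, Represents I F s G := by
  obtain ⟨t, ht⟩ := hI.1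
  have ho := hI.2.1
  have hc : ContDiffOn ℝ ∞ (fun _ : ℝ => (1 : ℝ)) I := contDiffOn_const
  cases F with
  | s1 δ δ' =>
    obtain ⟨-, -, -, rfl⟩ := h
    have e : Dt I (fun _ => 1) + δ • Ds I + δ' • Pv I = fun p =>
        ![1, δ * p.1 1, δ * p.1 2, 3 * δ * p.1 3, 3 / 2 * δ * p.1 4 + δ'] := by
      funext p i
      fin_cases i <;> simp [Dt, Ds, Pv] <;> ring
    refine ⟨fun p => ![1, δ * p 1, δ * p 2, 3 * δ * p 3, 3 / 2 * δ * p 4 + δ'], by rw [e],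
      e ▸ add_mem (add_mem (Dt_mem hc) (Submodule.smul_mem _ _ Ds_mem))
        (Submodule.smul_mem _ _ Pv_mem), ⟨pt t 0 0 0 0, pt_mem ht .., fun h => ?_⟩, trivial,
      fun h => ?_, fun p _ => rfl⟩
    · simpa using congrFun h 0
    · simpa using h _ (pt_mem ht 0 0 0 0)
  | s2 =>
    obtain rfl := h
    refine ⟨fun p => ![0, p 1, p 2, 3 * p 3, 3 / 2 * p 4], rfl, Ds_mem,
      ⟨pt t 1 0 0 0, pt_mem ht .., fun h => ?_⟩, fun p _ => rfl, fun h => ?_, fun p _ => rfl⟩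
    · simpa [pt] using congrFun h 1
    · simpa [pt] using h _ (pt_mem ht 1 1 0 0)
  | s3 δ =>
    obtain ⟨-, ρ, hρ, hne, rfl⟩ := h
    have e : Px I (fun _ => 1) + Py I ρ + δ • Pv I = fun p =>
        ![0, 1, ρ (p.1 0), -(1 / 2) * deriv ρ (p.1 0) * p.1 2 ^ 2, δ] := by
      funext p i
      fin_cases i <;> simp [Px, Py, Pv]
    refine ⟨fun p => ![0, 1, ρ (p 0), -(1 / 2) * deriv ρ (p 0) * p 2 ^ 2, δ], by rw [e],
      e ▸ add_mem (add_mem (Px_mem hc) (Py_mem hρ)) (Submodule.smul_mem _ _ Pv_mem),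
      ⟨pt t 0 0 0 0, pt_mem ht .., fun h => ?_⟩, fun p _ => rfl, fun h => ?_, fun p _ => rfl⟩
    · simpa using congrFun h 1
    · simpa [pt, hne t ht] using h _ (pt_mem ht 0 0 0 0)
  | s4 δ =>
    obtain ⟨-, β, hβ, rfl⟩ := h
    have e : Px I (fun _ => 1) + Ry I β + δ • Pv I = fun p =>
        ![0, 1, 0, β (p.1 0) * p.1 2, δ] := by
      funext p i
      fin_cases i <;> simp [Px, Ry, Pv]
    refine ⟨fun p => ![0, 1, 0, β (p 0) * p 2, δ], by rw [e],
      e ▸ add_mem (add_mem (Px_mem hc) (Ry_mem hβ)) (Submodule.smul_mem _ _ Pv_mem),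
      ⟨pt t 0 0 0 0, pt_mem ht .., fun h => ?_⟩, fun p _ => ⟨rfl, Or.inr rfl⟩, fun h => ?_,
      fun p _ => rfl⟩
    · simpa using congrFun h 1
    · simpa using h _ (pt_mem ht 0 0 0 0)
  | s5 δ =>
    obtain ⟨-, β, hβ, rfl⟩ := h
    have e : Rx I (fun _ => 1) + Ry I β + δ • Pv I = fun p =>
        ![0, 0, 0, p.1 1 + β (p.1 0) * p.1 2, δ] := by
      funext p i
      fin_cases i <;> simp [Rx, Ry, Pv]
    refine ⟨fun p => ![0, 0, 0, p 1 + β (p 0) * p 2, δ], by rw [e],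
      e ▸ add_mem (add_mem (Rx_mem hc) (Ry_mem hβ)) (Submodule.smul_mem _ _ Pv_mem),
      ⟨pt t 1 0 0 0, pt_mem ht .., fun h => ?_⟩, fun p _ => ⟨rfl, rfl, rfl⟩, fun h => ?_,
      fun p _ => rfl⟩
    · simpa [pt] using congrFun h 3
    · obtain ⟨L, hL, h0⟩ := h.2 _ (pt_mem ht 0 0 0 0)
      -- Along the x-axis the u-component is x itself, with derivative 1, whereas level 4 would
      -- force derivative 0.
      have hline : HasDerivAt (fun x : ℝ => pt t x 0 0 0) (pt 0 1 0 0 0) 0 := by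
        refine hasDerivAt_pi.2 fun i => ?_
        fin_cases i
        · exact hasDerivAt_const _ _
        · exact hasDerivAt_id _
        · exact hasDerivAt_const _ _
        · exact hasDerivAt_const _ _
        · exact hasDerivAt_const _ _
      have h1 := HasFDerivAt.comp_hasDerivAt (f := fun x : ℝ => pt t x 0 0 0) 0 hL hline
      rw [h0 _ rfl] at h1
      have h2 : HasDerivAt (fun x : ℝ => x) 0 0 := by
        simpa [Function.comp_def, pt] using h1
      exact zero_ne_one (h2.unique (hasDerivAt_id 0))
  | s6 δ =>
    obtain ⟨-, rfl⟩ := h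
    have e : Z I (fun t => t) + δ • Pv I = fun p => ![0, 0, 0, p.1 0, δ] := by
      funext p i
      fin_cases i <;> simp [Z, Pv]
    have hd : ∀ p : E, HasFDerivAt (fun p : E => p 0)
        (ContinuousLinearMap.proj (R := ℝ) (φ := fun _ : Fin 5 => ℝ) 0) p := fun p =>
      (ContinuousLinearMap.proj (R := ℝ) (φ := fun _ : Fin 5 => ℝ) 0).hasFDerivAt
    have hlev : ¬ Level I (fun p => ![0, 0, 0, p 0, δ]) 5 := fun h => by
      have h1 : HasFDerivAt (fun p : E => p 0) (0 : E →L[ℝ] ℝ) (pt t 0 0 0 0) :=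
        h.2 _ (pt_mem ht 0 0 0 0)
      have h2 := congrArg (fun L : E →L[ℝ] ℝ => L (pt 1 0 0 0 0)) (h1.unique (hd _))
      simp [pt] at h2
    refine ⟨fun p => ![0, 0, 0, p 0, δ], by rw [e],
      e ▸ add_mem (Z_mem contDiffOn_id) (Submodule.smul_mem _ _ Pv_mem), ?_,
      ⟨fun p _ => ⟨rfl, rfl, rfl⟩, fun p _ => ⟨_, hd p, fun w hw => hw⟩⟩, hlev, fun p _ => rfl⟩
    -- The interval may contain 0, where the u-component t vanishes. Instead of choosing a point, a
    -- zero field is excluded because it would have level 6 and so level 5.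
    by_contra! hcon
    exact hlev (Level.mono ho (by norm_num : 5 ≤ 6) ⟨fun p _ => ⟨rfl, rfl, rfl⟩, fun p hp => by
      simpa using congrFun (hcon p hp) 3⟩)
  | s7 δ =>
    obtain ⟨-, rfl⟩ := h
    have e : Z I (fun _ => 1) + δ • Pv I = fun p => ![0, 0, 0, 1, δ] := by
      funext p i
      fin_cases i <;> simp [Z, Pv]
    refine ⟨fun p => ![0, 0, 0, 1, δ], by rw [e],
      e ▸ add_mem (Z_mem hc) (Submodule.smul_mem _ _ Pv_mem),
      ⟨pt t 0 0 0 0, pt_mem ht .., fun h => ?_⟩,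
      ⟨fun p _ => ⟨rfl, rfl, rfl⟩, fun p _ => hasFDerivAt_const _ _⟩, fun h => ?_, fun p _ => rfl⟩
    · simpa using congrFun h 3
    · simpa using h.2 _ (pt_mem ht 0 0 0 0)
  | s8 =>
    obtain rfl := h
    refine ⟨fun p => ![0, 0, 0, 0, 1], rfl, Pv_mem,
      ⟨pt t 0 0 0 0, pt_mem ht .., fun h => ?_⟩,
      ⟨fun p _ => ⟨rfl, rfl, rfl⟩, fun p _ => rfl⟩, fun h => h, fun p _ => rfl⟩
    simpa using congrFun h 4

/-! ### Lines as subalgebras, and inequivalence of the families. -/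

theorem ext_smul {I : Set ℝ} (c : ℝ) (Q : VF I) : (c • Q).ext = c • Q.ext := by
  funext p
  by_cases hp : p ∈ slab I
  · have := ext_apply (c • Q) ⟨p, hp⟩
    rw [Pi.smul_apply, this, ext_apply Q ⟨p, hp⟩, Pi.smul_apply]
  · have hn : ¬ ∃ q : slab I, q.1 = p := fun ⟨q, hq⟩ => hp (hq ▸ q.2)
    simp [VF.ext, Function.extend_apply' _ _ _ hn]

theorem bracket_smul_smul {I : Set ℝ} (a b : ℝ) (Q : VF I) : bracket (a • Q) (b • Q) = 0 := by
  funext p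
  simp only [bracket, VectorField.lieBracket, ext_smul, fderiv_const_smul_field, Pi.smul_apply,
    smul_apply, map_smul, Pi.zero_apply]
  rw [smul_comm, sub_self]

theorem isOneDimSubalgebra_span {I : Set ℝ} {Q : VF I} (hQ : Q ∈ gL I) (h0 : Q ≠ 0) :
    IsOneDimSubalgebra I (Submodule.span ℝ {Q}) := by
  refine ⟨(Submodule.span_singleton_le_iff_mem _ _).2 hQ, fun R hR S hS => ?_,
    finrank_span_singleton h0⟩
  obtain ⟨a, rfl⟩ := Submodule.mem_span_singleton.1 hR
  obtain ⟨b, rfl⟩ := Submodule.mem_span_singleton.1 hS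
  rw [bracket_smul_smul]
  exact zero_mem _

theorem IsListed.isOneDimSubalgebra {I : Set ℝ} (hI : IsOpenInterval I) {F : Family}
    {s : Submodule ℝ (VF I)} (h : IsListed I F s) : IsOneDimSubalgebra I s := by
  obtain ⟨G, rfl, hG, ⟨p, hp, hne⟩, -⟩ := h.exists_represents hI
  exact isOneDimSubalgebra_span hG fun h0 => hne (congrFun h0 ⟨p, hp⟩)

/-- Two invariants suffice: the level, and whether the v-component vanishes identically, nowhere, or
neither. The third alternative occurs only for the dilation and for `s1` with `δ = 1`, whose levels
differ. -/
theorem IsListed.family_eq {I J : Set ℝ} (hI : IsOpenInterval I) (hJ : IsOpenInterval J)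
    {F F' : Family} {s : Submodule ℝ (VF I)} {s' : Submodule ℝ (VF J)} (h : IsListed I F s)
    (h' : IsListed J F' s') (heq : GLEquivalent s s') : F = F' := by
  obtain ⟨G, hs, -, -, hl, hl1, hv⟩ := h.exists_represents hI
  obtain ⟨G', hs', -, hne, hl', hl1', hv'⟩ := h'.exists_represents hJ
  have hR : LineRel I J G G' := GLEquivalent.lineRel hne (hs ▸ hs' ▸ heq)
  have hlev : F.level = F'.level := by
    refine le_antisymm ?_ ?_ <;> by_contra! hlt
    · exact hl1' (Level.mono hJ.2.1 hlt (hR.level hJ.2.1 hl))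
    · exact hl1 (Level.mono hI.2.1 hlt (hR.symm.level hI.2.1 hl'))
  -- On a nonempty slab the coordinate v takes all real values, so pointwise conditions on the
  -- v-component become conditions on `vcomp`.
  have key : ∀ {K : Set ℝ} {H : E → E} {F₀ : Family}, IsOpenInterval K →
      (∀ p ∈ slab K, H p 4 = F₀.vcomp (p 4)) → ∀ P : ℝ → Prop,
      ((∀ p ∈ slab K, P (H p 4)) ↔ ∀ v, P (F₀.vcomp v)) := by
    intro K H F₀ hK hH P
    obtain ⟨t, ht⟩ := hK.1
    exact ⟨fun h v => by
        have h1 := h _ (pt_mem ht 0 0 0 v)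
        rwa [hH _ (pt_mem ht 0 0 0 v)] at h1,
      fun h p hp => hH p hp ▸ h _⟩
  have hz : (∀ v, F.vcomp v = 0) ↔ ∀ v, F'.vcomp v = 0 := by
    rw [← key hI hv (· = 0), ← key hJ hv' (· = 0)]
    exact ⟨hR.v_eq_zero, hR.symm.v_eq_zero⟩
  have hn : (∀ v, F.vcomp v ≠ 0) ↔ ∀ v, F'.vcomp v ≠ 0 := by
    rw [← key hI hv (· ≠ 0), ← key hJ hv' (· ≠ 0)]
    exact ⟨hR.v_ne_zero, hR.symm.v_ne_zero⟩
  have hds : ¬ (∀ v : ℝ, 3 / 2 * v ≠ 0) := fun h => h 0 (by norm_num)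
  have hds' : ¬ (∀ v : ℝ, 3 / 2 * v = 0) := fun h => by simpa using h 1
  clear key hR hl hl1 hl' hl1' hv hv' hs hs' hne heq G G'
  -- Equality of levels leaves the pairs from the same family and the two mixed pairs of `s2` and
  -- `s3`.
  cases F <;> cases F' <;> try (exfalso; simp [Family.level] at hlev; done)
  · obtain ⟨h1, h2, h3, -⟩ := h
    obtain ⟨h1', h2', h3', -⟩ := h'
    simp only [Family.vcomp] at hz hn
    rcases h1 with rfl | rfl <;> rcases h2 with rfl | rfl <;> rcases h1' with rfl | rfl <;>
      rcases h2' with rfl | rfl <;> simp_all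
  · rfl
  · rcases h'.1 with rfl | rfl <;> clear h h' <;> simp_all [Family.vcomp]
  · rcases h.1 with rfl | rfl <;> clear h h' <;> simp_all [Family.vcomp]
  all_goals
    first
    | rfl
    | rcases h.1 with rfl | rfl <;> rcases h'.1 with rfl | rfl <;> clear h h' <;> simp_all [Family.vcomp]

/-! ### The action of the transformations on the algebra -/

/-- The general element of the algebra `𝔤_L`, on the whole space. -/
noncomputable def genField (τ χ ρ α β σ : ℝ → ℝ) (c d : ℝ) (p : E) : E :=
  ![τ (p 0), 1 / 3 * deriv τ (p 0) * p 1 + c * p 1 + χ (p 0),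
    1 / 3 * deriv τ (p 0) * p 2 + c * p 2 + ρ (p 0),
    -(1 / 18) * deriv (deriv τ) (p 0) * (p 1 ^ 3 + p 2 ^ 3) + 3 * c * p 3
      - 1 / 2 * deriv χ (p 0) * p 1 ^ 2 - 1 / 2 * deriv ρ (p 0) * p 2 ^ 2
      + α (p 0) * p 1 + β (p 0) * p 2 + σ (p 0),
    3 / 2 * c * p 4 + d]

/-- Some element of the pseudogroup pushes `G` on `I × ℝ⁴` forward to `G'` on `J × ℝ⁴`. -/
def Carries (I J : Set ℝ) (G G' : E → E) : Prop :=
  ∃ Φ ∈ GLax, Φ.source = slab I ∧ Φ.target = slab J ∧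
    ∀ p ∈ slab I, ∃ D : E →L[ℝ] E, HasFDerivAt Φ D p ∧ D (G p) = G' (Φ p)

theorem Carries.trans {I J K : Set ℝ} {G G' G'' : E → E} (h : Carries I J G G')
    (h' : Carries J K G' G'') : Carries I K G G'' := by
  obtain ⟨Φ, hΦ, hs, ht, h⟩ := h
  obtain ⟨Ψ, hΨ, hs', ht', h'⟩ := h'
  have e : Φ.target = Ψ.source := ht.trans hs'.symm
  refine ⟨Φ.trans Ψ, GLax.trans hΦ hΨ, ?_, ?_, fun p hp => ?_⟩
  · rw [OpenPartialHomeomorph.trans_source, ← e, ← hs]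
    exact inter_eq_left.2 Φ.mapsTo
  · rw [OpenPartialHomeomorph.trans_target, e, ← ht']
    exact inter_eq_left.2 Ψ.mapsTo_symm
  · obtain ⟨D, hD, hq⟩ := h p hp
    have hm : Φ p ∈ slab J := ht ▸ Φ.map_source (hs ▸ hp)
    obtain ⟨D', hD', hq'⟩ := h' _ hm
    exact ⟨D'.comp D, hD'.comp p hD, by simp [hq, hq']⟩

theorem Carries.congr_left {I J : Set ℝ} {G H G' : E → E} (h : Carries I J G G')
    (e : ∀ p ∈ slab I, H p = G p) : Carries I J H G' := by
  obtain ⟨Φ, hΦ, hs, ht, h⟩ := h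
  exact ⟨Φ, hΦ, hs, ht, fun p hp => by rw [e p hp]; exact h p hp⟩

theorem Carries.glEquivalent {I J : Set ℝ} {G G' : E → E} (h : Carries I J G G') :
    GLEquivalent (Submodule.span ℝ {(fun p => G p.1 : VF I)})
      (Submodule.span ℝ {(fun p => G' p.1 : VF J)}) := by
  obtain ⟨Φ, hΦ, hs, ht, h⟩ := h
  refine ⟨Φ, hΦ, hs, ht, ?_⟩
  have key : pushforward Φ J (fun p => G p.1 : VF I) = fun q => G' q.1 := by
    funext q
    have hq : q.1 ∈ Φ.target := ht.symm ▸ q.2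
    have hp : Φ.symm q.1 ∈ slab I := hs ▸ Φ.map_target hq
    obtain ⟨D, hD, e⟩ := h _ hp
    rw [Φ.right_inv hq] at e
    simp only [pushforward]
    rw [hD.fderiv, ext_apply _ ⟨_, hp⟩, e]
  ext R
  simp only [SetLike.mem_coe, Submodule.mem_span_singleton, mem_image]
  constructor
  · rintro ⟨c, rfl⟩
    exact ⟨_, ⟨c, rfl⟩, by rw [pushforward_smul Φ hs ht, key]⟩
  · rintro ⟨_, ⟨c, rfl⟩, rfl⟩
    exact ⟨c, by rw [pushforward_smul Φ hs ht, key]⟩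

/-- Since `I` is open, agreement of the parameter functions on `I` carries over to their
derivatives. This allows functions vanishing on `I` to be replaced by the zero function. -/
theorem genField_congr {I : Set ℝ} (hI : IsOpen I) {τ χ ρ α β σ τ' χ' ρ' α' β' σ' : ℝ → ℝ}
    {c d c' d' : ℝ} (hτ : EqOn τ τ' I) (hχ : EqOn χ χ' I) (hρ : EqOn ρ ρ' I)
    (hα : EqOn α α' I) (hβ : EqOn β β' I) (hσ : EqOn σ σ' I) (hc : c = c') (hd : d = d')
    {p : E} (hp : p ∈ slab I) :
    genField τ χ ρ α β σ c d p = genField τ' χ' ρ' α' β' σ' c' d' p := by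
  have hp : p 0 ∈ I := hp
  have h1 := deriv_eqOn hI hτ
  have h2 := deriv_eqOn hI h1
  simp only [genField, hτ hp, hχ hp, hρ hp, hα hp, hβ hp, hσ hp, h1 hp, h2 hp,
    deriv_eqOn hI hχ hp, deriv_eqOn hI hρ hp, hc, hd]

/-- The transformations with `T = t` and `A = 1` fix τ and c. The hypotheses are the pushforward
equated coefficient by coefficient in the new x and y. Once the new coefficients are prescribed,
they are a triangular system: first for X and Y, then for W₁ and W₂, then for W₀. -/
theorem carries_shift {I : Set ℝ} (hI : IsOpenInterval I) {τ χ ρ α β σ χ' ρ' α' β' σ' : ℝ → ℝ}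
    {X Y W₀ W₁ W₂ : ℝ → ℝ} {c d d' : ℝ} (B : ℝ) (hτ : ContDiffOn ℝ ∞ τ I)
    (hχ : ContDiffOn ℝ ∞ χ I) (hρ : ContDiffOn ℝ ∞ ρ I) (hX : ContDiffOn ℝ ∞ X I)
    (hY : ContDiffOn ℝ ∞ Y I) (hW₀ : ContDiffOn ℝ ∞ W₀ I) (hW₁ : ContDiffOn ℝ ∞ W₁ I)
    (hW₂ : ContDiffOn ℝ ∞ W₂ I)
    (eχ : ∀ t ∈ I, χ' t = χ t + τ t * deriv X t - (1 / 3 * deriv τ t + c) * X t)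
    (eρ : ∀ t ∈ I, ρ' t = ρ t + τ t * deriv Y t - (1 / 3 * deriv τ t + c) * Y t)
    (eα : ∀ t ∈ I, α' t = α t + τ t * deriv W₁ t - deriv X t * χ t
      + W₁ t * (1 / 3 * deriv τ t - 2 * c) + 1 / 6 * deriv (deriv τ) t * X t ^ 2
      + deriv χ' t * X t)
    (eβ : ∀ t ∈ I, β' t = β t + τ t * deriv W₂ t - deriv Y t * ρ t
      + W₂ t * (1 / 3 * deriv τ t - 2 * c) + 1 / 6 * deriv (deriv τ) t * Y t ^ 2
      + deriv ρ' t * Y t)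
    (eσ : ∀ t ∈ I, σ' t = σ t + τ t * deriv W₀ t + W₁ t * χ t + W₂ t * ρ t - 3 * c * W₀ t
      + 1 / 18 * deriv (deriv τ) t * (X t ^ 3 + Y t ^ 3)
      + 1 / 2 * deriv χ' t * X t ^ 2 + 1 / 2 * deriv ρ' t * Y t ^ 2 - α' t * X t - β' t * Y t)
    (ed : d' = d - 3 / 2 * c * B) :
    Carries I I (genField τ χ ρ α β σ c d) (genField τ χ' ρ' α' β' σ' c d') := by
  have ho := hI.2.1
  have hT : ContDiffOn ℝ ∞ (fun t : ℝ => t) I := contDiffOn_id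
  have hT' : ∀ t ∈ I, deriv (fun t : ℝ => t) t ≠ 0 := fun t _ => by simp
  obtain ⟨Φ, J, R, hΦ, hJ, hs, ht, hf, hTI, hRJ, hRT, hTR, -⟩ :=
    exists_formMap_homeo hI B one_ne_zero hT hT' hX hY hW₀ hW₁ hW₂
  obtain rfl : I = J := Subset.antisymm hTI fun t h => hTR t h ▸ hRJ h
  refine ⟨Φ, hΦ, hs, ht, fun p hp => ?_⟩
  obtain ⟨g', k', m₁', m₂', D, hD, hg, hk, hm₁, hm₂, hw⟩ :=
    hasFDerivAt_formMap ho 1 B hT hT' hX hY hW₀ hW₁ hW₂ hp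
  have hp0 : p 0 ∈ I := hp
  have hd : ∀ {f : ℝ → ℝ}, ContDiffOn ℝ ∞ f I → HasDerivAt f (deriv f (p 0)) (p 0) :=
    fun hf => hasDerivAt_of_contDiffOn ho hf hp
  simp only [deriv_id'', cbrt_one] at hg hk hm₁ hm₂ hw
  have e1 : g' = 0 := hg.unique (hasDerivAt_const _ _)
  have e2 : k' = 0 := by
    refine hk.unique ?_
    simpa using hasDerivAt_const (p 0) (0 : ℝ)
  have e3 : m₁' = 1 / 2 * deriv (deriv X) (p 0) :=
    hm₁.unique (by simpa using (hd (contDiffOn_deriv ho hX)).const_mul (1 / 2 : ℝ))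
  have e4 : m₂' = 1 / 2 * deriv (deriv Y) (p 0) :=
    hm₂.unique (by simpa using (hd (contDiffOn_deriv ho hY)).const_mul (1 / 2 : ℝ))
  have hτ1 := hd (contDiffOn_deriv ho hτ)
  -- The x²-coefficient of the new field contains the derivative of χ'; its second derivative of X
  -- matches the term from `m₁'`.
  have dχ : deriv χ' (p 0) = deriv χ (p 0) + (deriv τ (p 0) * deriv X (p 0)
      + τ (p 0) * deriv (deriv X) (p 0)) - (1 / 3 * deriv (deriv τ) (p 0) * X (p 0)
      + (1 / 3 * deriv τ (p 0) + c) * deriv X (p 0)) := by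
    rw [deriv_eqOn ho eχ hp0]
    exact (((hd hχ).add ((hd hτ).mul (hd (contDiffOn_deriv ho hX)))).sub
      (((hτ1.const_mul (1 / 3)).add_const c).mul (hd hX))).deriv
  have dρ : deriv ρ' (p 0) = deriv ρ (p 0) + (deriv τ (p 0) * deriv Y (p 0)
      + τ (p 0) * deriv (deriv Y) (p 0)) - (1 / 3 * deriv (deriv τ) (p 0) * Y (p 0)
      + (1 / 3 * deriv τ (p 0) + c) * deriv Y (p 0)) := by
    rw [deriv_eqOn ho eρ hp0]
    exact (((hd hρ).add ((hd hτ).mul (hd (contDiffOn_deriv ho hY)))).sub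
      (((hτ1.const_mul (1 / 3)).add_const c).mul (hd hY))).deriv
  refine ⟨D, by rw [hf]; exact hD, ?_⟩
  rw [hw, hf]
  funext i
  fin_cases i
  · simp [genField, formMap]
  · simp [genField, formMap, e1, eχ _ hp0, cbrt_one]; ring
  · simp [genField, formMap, e1, eρ _ hp0, cbrt_one]; ring
  · simp [genField, formMap, e2, e3, e4, cbrt_one, dχ, dρ, eσ _ hp0, eα _ hp0, eβ _ hp0]; ring
  · simp [genField, formMap, ed]; ring

/-- The permutation has the whole space as its domain; composing it with the identity of the slab,
itself a generator, gives the required domain. -/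
theorem carries_swap {I : Set ℝ} (hI : IsOpenInterval I) (τ χ ρ α β σ : ℝ → ℝ) (c d : ℝ) :
    Carries I I (genField τ χ ρ α β σ c d) (genField τ ρ χ β α σ c d) := by
  let e : OpenPartialHomeomorph E E :=
    { toFun := swapL
      invFun := swapL
      source := univ
      target := univ
      map_source' := fun _ _ => mem_univ _
      map_target' := fun _ _ => mem_univ _
      left_inv' := fun p _ => by
        funext i
        fin_cases i <;> simp [swapL_apply]
      right_inv' := fun p _ => by
        funext i
        fin_cases i <;> simp [swapL_apply]
      open_source := isOpen_univ
      open_target := isOpen_univ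
      continuousOn_toFun := swapL.continuous.continuousOn
      continuousOn_invFun := swapL.continuous.continuousOn }
  have he : e ∈ GLax := mem_GLax_of_generator (Or.inr ⟨rfl, swapL_apply⟩)
  have h0 : ContDiffOn ℝ ∞ (fun _ : ℝ => (0 : ℝ)) I := contDiffOn_const
  obtain ⟨Φ, J, R, hΦ, hJ, hs, ht, hf, hTI, hRJ, hRT, hTR, -⟩ :=
    exists_formMap_homeo hI 0 one_ne_zero contDiffOn_id (fun t _ => by simp) h0 h0 h0 h0 h0
  obtain rfl : I = J := Subset.antisymm hTI fun t h => hTR t h ▸ hRJ h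
  have hid : ∀ p, Φ p = p := fun p => by
    rw [hf]
    funext i
    fin_cases i <;> simp [formMap, cbrt_one]
  refine ⟨Φ.trans e, GLax.trans hΦ he, ?_, ?_, fun p _ => ⟨swapL, ?_, ?_⟩⟩
  · rw [OpenPartialHomeomorph.trans_source, hs]
    exact inter_univ _
  · rw [OpenPartialHomeomorph.trans_target, ht]
    ext q
    have : (swapL q) 0 = q 0 := by simp [swapL_apply]
    simp [e, slab, this]
  · refine swapL.hasFDerivAt.congr_of_eventuallyEq (Eventually.of_forall fun q => ?_)
    change swapL (Φ q) = swapL q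
    rw [hid]
  · change _ = genField τ ρ χ β α σ c d (swapL (Φ p))
    rw [hid]
    funext i
    fin_cases i <;> simp [swapL_apply, genField]
    ring

/-- Straightening of the `∂_t`-component. -/
theorem carries_straighten {I : Set ℝ} (hI : IsOpenInterval I) {τ T : ℝ → ℝ} (c d : ℝ)
    {A l : ℝ} (hA : A ≠ 0) (hτ : ContDiffOn ℝ ∞ τ I) (hT : ContDiffOn ℝ ∞ T I)
    (hT' : ∀ t ∈ I, deriv T t ≠ 0) (hl : ∀ t ∈ I, deriv T t * τ t = l) :
    ∃ J, IsOpenInterval J ∧ Carries I J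
      (genField τ (fun _ => 0) (fun _ => 0) (fun _ => 0) (fun _ => 0) (fun _ => 0) c d)
      (genField (fun _ => l) (fun _ => 0) (fun _ => 0) (fun _ => 0) (fun _ => 0) (fun _ => 0)
        c (A * d)) := by
  have ho := hI.2.1
  have h0 : ContDiffOn ℝ ∞ (fun _ : ℝ => (0 : ℝ)) I := contDiffOn_const
  obtain ⟨Φ, J, R, hΦ, hJ, hs, ht, hf, -⟩ := exists_formMap_homeo hI 0 hA hT hT' h0 h0 h0 h0 h0
  refine ⟨J, hJ, Φ, hΦ, hs, ht, fun p hp => ?_⟩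
  obtain ⟨g', k', m₁', m₂', D, hD, hg, hk, hm₁, hm₂, hw⟩ :=
    hasFDerivAt_formMap ho A 0 hT hT' h0 h0 h0 h0 h0 hp
  have hp0 : p 0 ∈ I := hp
  have hd : ∀ {f : ℝ → ℝ}, ContDiffOn ℝ ∞ f I → HasDerivAt f (deriv f (p 0)) (p 0) :=
    fun hf => hasDerivAt_of_contDiffOn ho hf hp
  have hT1 := contDiffOn_deriv ho hT
  -- Differentiation of the constant `T_t τ`.
  have e1 : ∀ t ∈ I, deriv (deriv T) t * τ t + deriv T t * deriv τ t = 0 := fun t ht =>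
    (((hasDerivAt_of_contDiffOn ho hT1 ht).mul (hasDerivAt_of_contDiffOn ho hτ ht)).unique
      ((hasDerivAt_const t l).congr_of_eventuallyEq (eventuallyEq_of_mem (ho.mem_nhds ht) hl)))
  -- By `e1` the product of the cubic coefficient with τ equals `-(A ^ 2 / 18) τ_t`; its derivative
  -- cancels the cubic terms in the u-component.
  have e2 : k' * τ (p 0) + A ^ 2 * deriv (deriv T) (p 0) / (18 * deriv T (p 0)) * deriv τ (p 0)
      = -(A ^ 2 / 18) * deriv (deriv τ) (p 0) := by
    refine (hk.mul (hd hτ)).unique (((hd (contDiffOn_deriv ho hτ)).const_mul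
      (-(A ^ 2 / 18))).congr_of_eventuallyEq (eventuallyEq_of_mem (ho.mem_nhds hp) fun t ht => ?_))
    have := hT' t ht
    simp only [Pi.mul_apply]
    field_simp
    linear_combination e1 t ht
  have e3 : 3 * cbrt (deriv T (p 0)) ^ 2 * g' = deriv (deriv T) (p 0) := by
    have h := hg.pow 3
    have h2 : (fun t => cbrt (deriv T t)) ^ 3 = deriv T := funext fun t => cbrt_pow_three _
    rw [h2] at h
    simpa using h.unique (hd hT1)
  have hg0 := cbrt_ne_zero (hT' _ hp0)
  -- This is `e1` with `T_t` written as a cube and the factor `3 g ^ 2` cancelled; it removes the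
  -- terms linear in x and y from their components.
  have e4 : g' * τ (p 0) + 1 / 3 * cbrt (deriv T (p 0)) * deriv τ (p 0) = 0 := by
    have h := e1 _ hp0
    rw [← e3] at h
    nth_rewrite 2 [← cbrt_pow_three (deriv T (p 0))] at h
    have h5 : 3 * cbrt (deriv T (p 0)) ^ 2 *
      (g' * τ (p 0) + 1 / 3 * cbrt (deriv T (p 0)) * deriv τ (p 0)) = 0 := by
      linear_combination h
    exact (mul_eq_zero.1 h5).resolve_left (mul_ne_zero three_ne_zero (pow_ne_zero 2 hg0))
  have e5 : m₁' = 0 := hm₁.unique (by simpa using hasDerivAt_const (p 0) (0 : ℝ))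
  have e6 : m₂' = 0 := hm₂.unique (by simpa using hasDerivAt_const (p 0) (0 : ℝ))
  refine ⟨D, by rw [hf]; exact hD, ?_⟩
  rw [hw, hf]
  funext i
  fin_cases i
  · simp [genField, formMap, hl _ hp0]
  · simp [genField, formMap]; linear_combination cbrt A ^ 2 * p 1 * e4
  · simp [genField, formMap]; linear_combination cbrt A ^ 2 * p 2 * e4
  · simp [genField, formMap, e5, e6]; linear_combination (-(p 1 ^ 3 + p 2 ^ 3)) * e2
  · simp [genField, formMap]; ring

/-- The action of reparameterizations of `t` and of scalings on the elements without
`∂_t`-component and dilation. -/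
theorem exists_carries_scale {I : Set ℝ} (hI : IsOpenInterval I) {T : ℝ → ℝ} {A : ℝ}
    (hA : A ≠ 0) (hT : ContDiffOn ℝ ∞ T I) (hT' : ∀ t ∈ I, deriv T t ≠ 0) :
    ∃ (J : Set ℝ) (R : ℝ → ℝ), IsOpenInterval J ∧ MapsTo R J I ∧ (∀ t ∈ I, R (T t) = t) ∧
      (∀ t ∈ J, T (R t) = t) ∧ ContDiffOn ℝ ∞ R J ∧
      ∀ (χ ρ α β σ χ' ρ' α' β' σ' : ℝ → ℝ) (d : ℝ), ContDiffOn ℝ ∞ χ I → ContDiffOn ℝ ∞ ρ I →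
        ContDiffOn ℝ ∞ χ' J → ContDiffOn ℝ ∞ ρ' J →
        (∀ t ∈ I, χ' (T t) = cbrt A ^ 2 * cbrt (deriv T t) * χ t) →
        (∀ t ∈ I, ρ' (T t) = cbrt A ^ 2 * cbrt (deriv T t) * ρ t) →
        (∀ t ∈ I, α' (T t) * (cbrt A ^ 2 * cbrt (deriv T t)) = A ^ 2 * α t) →
        (∀ t ∈ I, β' (T t) * (cbrt A ^ 2 * cbrt (deriv T t)) = A ^ 2 * β t) →
        (∀ t ∈ I, σ' (T t) = A ^ 2 * σ t) →
        Carries I J (genField (fun _ => 0) χ ρ α β σ 0 d)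
          (genField (fun _ => 0) χ' ρ' α' β' σ' 0 (A * d)) := by
  have ho := hI.2.1
  have h0 : ContDiffOn ℝ ∞ (fun _ : ℝ => (0 : ℝ)) I := contDiffOn_const
  obtain ⟨Φ, J, R, hΦ, hJ, hs, ht, hf, hTI, hRJ, hRT, hTR, hR⟩ :=
    exists_formMap_homeo hI 0 hA hT hT' h0 h0 h0 h0 h0
  refine ⟨J, R, hJ, hRJ, hRT, hTR, hR, ?_⟩
  intro χ ρ α β σ χ' ρ' α' β' σ' d hχ hρ hχ' hρ' eχ eρ eα eβ eσ
  refine ⟨Φ, hΦ, hs, ht, fun p hp => ?_⟩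
  obtain ⟨g', k', m₁', m₂', D, hD, hg, hk, hm₁, hm₂, hw⟩ :=
    hasFDerivAt_formMap ho A 0 hT hT' h0 h0 h0 h0 h0 hp
  have hp0 : p 0 ∈ I := hp
  have hd : ∀ {f : ℝ → ℝ}, ContDiffOn ℝ ∞ f I → HasDerivAt f (deriv f (p 0)) (p 0) :=
    fun hf => hasDerivAt_of_contDiffOn ho hf hp
  have e3 : 3 * cbrt (deriv T (p 0)) ^ 2 * g' = deriv (deriv T) (p 0) := by
    have h := hg.pow 3
    have h2 : (fun t => cbrt (deriv T t)) ^ 3 = deriv T := funext fun t => cbrt_pow_three _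
    rw [h2] at h
    simpa using h.unique (hd (contDiffOn_deriv ho hT))
  have key : ∀ {f f' : ℝ → ℝ}, ContDiffOn ℝ ∞ f I → ContDiffOn ℝ ∞ f' J →
      (∀ t ∈ I, f' (T t) = cbrt A ^ 2 * cbrt (deriv T t) * f t) →
      deriv f' (T (p 0)) * deriv T (p 0) = cbrt A ^ 2 * g' * f (p 0)
        + cbrt A ^ 2 * cbrt (deriv T (p 0)) * deriv f (p 0) := fun hf hf' e =>
    ((hasDerivAt_of_contDiffOn hJ.2.1 hf' (hTI hp0)).comp (p 0) (hd hT)).unique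
      (((hg.const_mul (cbrt A ^ 2)).mul (hd hf)).congr_of_eventuallyEq
        (eventuallyEq_of_mem (ho.mem_nhds hp) e))
  have k1 := key hχ hχ' eχ
  have k2 := key hρ hρ' eρ
  have hg0 := cbrt_ne_zero (hT' _ hp0)
  have hT3 := cbrt_pow_three (deriv T (p 0))
  have hA2 : A ^ 2 = cbrt A ^ 6 := by
    linear_combination -(cbrt A ^ 3 + A) * cbrt_pow_three A
  -- With `A` and `T_t` written as cubes, the chain rule for χ' or ρ' becomes the identity between
  -- the quadratic coefficients of the u-component.
  have quad : ∀ {f' f₀ f₁ : ℝ}, f' * deriv T (p 0) = cbrt A ^ 2 * g' * f₀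
      + cbrt A ^ 2 * cbrt (deriv T (p 0)) * f₁ →
      f' * (cbrt A ^ 2 * cbrt (deriv T (p 0))) ^ 2 = A ^ 2 * f₁
        + A ^ 2 * deriv (deriv T) (p 0) / (3 * deriv T (p 0)) * f₀ := by
    intro f' f₀ f₁ h
    rw [← e3, hA2]
    clear * - h hg0 hT3
    generalize cbrt A = b at *
    generalize cbrt (deriv T (p 0)) = g at *
    rw [← hT3] at h ⊢
    field_simp
    linear_combination b ^ 4 * h
  have q1 := quad k1
  have q2 := quad k2
  have e5 : m₁' = 0 := hm₁.unique (by simpa using hasDerivAt_const (p 0) (0 : ℝ))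
  have e6 : m₂' = 0 := hm₂.unique (by simpa using hasDerivAt_const (p 0) (0 : ℝ))
  refine ⟨D, by rw [hf]; exact hD, ?_⟩
  rw [hw, hf]
  funext i
  fin_cases i
  · simp [genField, formMap]
  · simp [genField, formMap, eχ _ hp0]
  · simp [genField, formMap, eρ _ hp0]
  · simp [genField, formMap, e5, e6, eσ _ hp0]
    linear_combination p 1 ^ 2 / 2 * q1 + p 2 ^ 2 / 2 * q2 - p 1 * eα _ hp0 - p 2 * eβ _ hp0
  · simp [genField, formMap]

/-! ### Normalization of the elements of the algebra -/

theorem exists_genField_of_mem_gL {I : Set ℝ} (hI : IsOpen I) {Q : VF I} (hQ : Q ∈ gL I) :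
    ∃ (τ χ ρ α β σ : ℝ → ℝ) (c d : ℝ), ContDiffOn ℝ ∞ τ I ∧ ContDiffOn ℝ ∞ χ I ∧
      ContDiffOn ℝ ∞ ρ I ∧ ContDiffOn ℝ ∞ α I ∧ ContDiffOn ℝ ∞ β I ∧ ContDiffOn ℝ ∞ σ I ∧
      Q = fun p => genField τ χ ρ α β σ c d p.1 := by
  have h0 : ContDiffOn ℝ ∞ (fun _ : ℝ => (0 : ℝ)) I := contDiffOn_const
  have d0 : deriv (fun _ : ℝ => (0 : ℝ)) = fun _ => 0 := by funext t; simp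
  induction hQ using Submodule.span_induction with
  | mem Q h =>
    rcases h with ((((((⟨f, hf, rfl⟩ | rfl) | ⟨f, hf, rfl⟩) | ⟨f, hf, rfl⟩) | ⟨f, hf, rfl⟩) |
      ⟨f, hf, rfl⟩) | ⟨f, hf, rfl⟩) | rfl
    · refine ⟨f, _, _, _, _, _, 0, 0, hf, h0, h0, h0, h0, h0, ?_⟩
      funext p i
      fin_cases i <;> simp [Dt, genField]
    · refine ⟨_, _, _, _, _, _, 1, 0, h0, h0, h0, h0, h0, h0, ?_⟩
      funext p i
      fin_cases i <;> simp [Ds, genField, d0]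
    · refine ⟨_, f, _, _, _, _, 0, 0, h0, hf, h0, h0, h0, h0, ?_⟩
      funext p i
      fin_cases i <;> simp [Px, genField, d0]
    · refine ⟨_, _, f, _, _, _, 0, 0, h0, h0, hf, h0, h0, h0, ?_⟩
      funext p i
      fin_cases i <;> simp [Py, genField, d0]
    · refine ⟨_, _, _, f, _, _, 0, 0, h0, h0, h0, hf, h0, h0, ?_⟩
      funext p i
      fin_cases i <;> simp [Rx, genField, d0]
    · refine ⟨_, _, _, _, f, _, 0, 0, h0, h0, h0, h0, hf, h0, ?_⟩
      funext p i
      fin_cases i <;> simp [Ry, genField, d0]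
    · refine ⟨_, _, _, _, _, f, 0, 0, h0, h0, h0, h0, h0, hf, ?_⟩
      funext p i
      fin_cases i <;> simp [Z, genField, d0]
    · refine ⟨_, _, _, _, _, _, 0, 1, h0, h0, h0, h0, h0, h0, ?_⟩
      funext p i
      fin_cases i <;> simp [Pv, genField, d0]
  | zero =>
    refine ⟨_, _, _, _, _, _, 0, 0, h0, h0, h0, h0, h0, h0, ?_⟩
    funext p i
    fin_cases i <;> simp [genField, d0]
  | add Q R _ _ hQ hR =>
    obtain ⟨τ, χ, ρ, α, β, σ, c, d, hτ, hχ, hρ, hα, hβ, hσ, rfl⟩ := hQ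
    obtain ⟨τ', χ', ρ', α', β', σ', c', d', hτ', hχ', hρ', hα', hβ', hσ', rfl⟩ := hR
    refine ⟨τ + τ', χ + χ', ρ + ρ', α + α', β + β', σ + σ', c + c', d + d', hτ.add hτ',
      hχ.add hχ', hρ.add hρ', hα.add hα', hβ.add hβ', hσ.add hσ', ?_⟩
    have key : ∀ {f g : ℝ → ℝ}, ContDiffOn ℝ ∞ f I → ContDiffOn ℝ ∞ g I →
        EqOn (deriv (f + g)) (deriv f + deriv g) I := fun hf hg t ht =>
      ((hasDerivAt_of_contDiffOn hI hf ht).add (hasDerivAt_of_contDiffOn hI hg ht)).deriv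
    funext p i
    have hp : p.1 0 ∈ I := p.2
    have e1 := key hτ hτ'
    have e2 := (deriv_eqOn hI e1 hp).trans
      (key (contDiffOn_deriv hI hτ) (contDiffOn_deriv hI hτ') hp)
    fin_cases i <;> simp [genField, e1 hp, e2, key hχ hχ' hp, key hρ hρ' hp] <;> ring
  | smul a Q _ hQ =>
    obtain ⟨τ, χ, ρ, α, β, σ, c, d, hτ, hχ, hρ, hα, hβ, hσ, rfl⟩ := hQ
    refine ⟨fun t => a * τ t, fun t => a * χ t, fun t => a * ρ t, fun t => a * α t,
      fun t => a * β t, fun t => a * σ t, a * c, a * d, contDiffOn_const.mul hτ,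
      contDiffOn_const.mul hχ, contDiffOn_const.mul hρ, contDiffOn_const.mul hα,
      contDiffOn_const.mul hβ, contDiffOn_const.mul hσ, ?_⟩
    have key : ∀ f : ℝ → ℝ, deriv (fun t => a * f t) = fun t => a * deriv f t := fun f => by
      funext t; exact deriv_const_mul_field a
    funext p i
    fin_cases i <;> simp [genField, key] <;> ring

/-- The vector field `G` on `I × ℝ⁴` can be carried to a basis field of a member of the list. -/
def Normalizable (I : Set ℝ) (G : E → E) : Prop :=
  ∃ (J : Set ℝ) (G' : E → E) (F : Family), IsOpenInterval J ∧ Carries I J G G' ∧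
    IsListed J F (Submodule.span ℝ {(fun p => G' p.1 : VF J)})

theorem Carries.normalizable {I J : Set ℝ} {G G' : E → E} (h : Carries I J G G')
    (h' : Normalizable J G') : Normalizable I G := by
  obtain ⟨K, H, F, hK, hc, hl⟩ := h'
  exact ⟨K, H, F, hK, h.trans hc, hl⟩

theorem Normalizable.congr {I : Set ℝ} {G H : E → E} (h : Normalizable I G)
    (e : ∀ p ∈ slab I, H p = G p) : Normalizable I H := by
  obtain ⟨K, G', F, hK, hc, hl⟩ := h
  exact ⟨K, G', F, hK, hc.congr_left e, hl⟩

theorem span_eq_of_smul {J : Set ℝ} {Q R : VF J} {l : ℝ} (hl : l ≠ 0) (h : Q = l • R) :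
    Submodule.span ℝ {Q} = Submodule.span ℝ {R} := by
  rw [h]
  exact Submodule.span_singleton_smul_eq (IsUnit.mk0 l hl) R

section Cases

variable {I : Set ℝ} {τ χ ρ α β σ : ℝ → ℝ} {c d : ℝ}

/-- A factor normalizing the constant `∂_v`-component. -/
theorem exists_factor (d : ℝ) : ∃ A δ : ℝ, A ≠ 0 ∧ (δ = 0 ∨ δ = 1) ∧ A * d = δ := by
  by_cases hd : d = 0
  · exact ⟨1, 0, one_ne_zero, Or.inl rfl, by simp [hd]⟩
  · exact ⟨d⁻¹, 1, inv_ne_zero hd, Or.inr rfl, inv_mul_cancel₀ hd⟩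

/-- In the presence of the dilation, a translation of v removes the ∂_v-term. -/
theorem exists_shift_constant (c d : ℝ) : ∃ B : ℝ, c = 0 ∨ d - 3 / 2 * c * B = 0 := by
  by_cases hc : c = 0
  · exact ⟨0, Or.inl hc⟩
  · exact ⟨d / (3 / 2 * c), Or.inr (by field_simp; ring)⟩

/-- Where τ has no zeros, the shift equations with zero target are linear ODEs that can be solved
for the derivatives of X, Y, W₁, W₂, W₀. What remains involves τ, c and d only, and is straightened
by a new time. -/
theorem normalizable_of_tau_ne_zero (hI : IsOpenInterval I) (hτ : ContDiffOn ℝ ∞ τ I)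
    (hχ : ContDiffOn ℝ ∞ χ I) (hρ : ContDiffOn ℝ ∞ ρ I) (hα : ContDiffOn ℝ ∞ α I)
    (hβ : ContDiffOn ℝ ∞ β I) (hσ : ContDiffOn ℝ ∞ σ I) (h : ∀ t ∈ I, τ t ≠ 0) :
    Normalizable I (genField τ χ ρ α β σ c d) := by
  have ho := hI.2.1
  have hτ1 := contDiffOn_deriv ho hτ
  have hτ2 := contDiffOn_deriv ho hτ1
  have hp : ContDiffOn ℝ ∞ (fun t => (1 / 3 * deriv τ t + c) / τ t) I :=
    ((contDiffOn_const.mul hτ1).add contDiffOn_const).div hτ h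
  have hr : ContDiffOn ℝ ∞ (fun t => -(1 / 3 * deriv τ t - 2 * c) / τ t) I :=
    ((contDiffOn_const.mul hτ1).sub contDiffOn_const).neg.div hτ h
  obtain ⟨X, hX, eX⟩ := exists_linear_ode hI hp (q := fun t => -χ t / τ t) (hχ.neg.div hτ h)
  obtain ⟨Y, hY, eY⟩ := exists_linear_ode hI hp (q := fun t => -ρ t / τ t) (hρ.neg.div hτ h)
  have hX1 := contDiffOn_deriv ho hX
  have hY1 := contDiffOn_deriv ho hY
  obtain ⟨W₁, hW₁, eW₁⟩ := exists_linear_ode hI hr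
    (q := fun t => (deriv X t * χ t - α t - 1 / 6 * deriv (deriv τ) t * X t ^ 2) / τ t)
    ((((hX1.mul hχ).sub hα).sub ((contDiffOn_const.mul hτ2).mul (hX.pow 2))).div hτ h)
  obtain ⟨W₂, hW₂, eW₂⟩ := exists_linear_ode hI hr
    (q := fun t => (deriv Y t * ρ t - β t - 1 / 6 * deriv (deriv τ) t * Y t ^ 2) / τ t)
    ((((hY1.mul hρ).sub hβ).sub ((contDiffOn_const.mul hτ2).mul (hY.pow 2))).div hτ h)
  obtain ⟨W₀, hW₀, eW₀⟩ := exists_linear_ode hI (p := fun t => 3 * c / τ t)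
    (q := fun t => (-σ t - W₁ t * χ t - W₂ t * ρ t
      - 1 / 18 * deriv (deriv τ) t * (X t ^ 3 + Y t ^ 3)) / τ t)
    (contDiffOn_const.div hτ h)
    ((((hσ.neg.sub (hW₁.mul hχ)).sub (hW₂.mul hρ)).sub ((contDiffOn_const.mul hτ2).mul
      ((hX.pow 3).add (hY.pow 3)))).div hτ h)
  obtain ⟨B, hB⟩ := exists_shift_constant c d
  have hshift : Carries I I (genField τ χ ρ α β σ c d)
      (genField τ (fun _ => 0) (fun _ => 0) (fun _ => 0) (fun _ => 0) (fun _ => 0) c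
        (d - 3 / 2 * c * B)) := by
    refine carries_shift hI B hτ hχ hρ hX hY hW₀ hW₁ hW₂ ?_ ?_ ?_ ?_ ?_ rfl <;> intro t ht <;>
      have := h t ht
    · rw [eX t ht]; field_simp; ring
    · rw [eY t ht]; field_simp; ring
    · simp only [deriv_const']; rw [eW₁ t ht]; field_simp; ring
    · simp only [deriv_const']; rw [eW₂ t ht]; field_simp; ring
    · simp only [deriv_const']; rw [eW₀ t ht]; field_simp; ring
  refine hshift.normalizable ?_
  generalize d - 3 / 2 * c * B = d at hB
  -- The straightened field is `l` times a listed one. For nonzero c the choice `l = c` gives `δ =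
  -- 1`, and d is already 0; for `c = 0` the factor `A` normalizes d.
  obtain ⟨A, l, δ, δ', hA, hl, hδ, hδ', hδδ', e1, e2⟩ : ∃ A l δ δ' : ℝ, A ≠ 0 ∧ l ≠ 0 ∧
      (δ = 0 ∨ δ = 1) ∧ (δ' = 0 ∨ δ' = 1) ∧ δ * δ' = 0 ∧ c = l * δ ∧ A * d = l * δ' := by
    by_cases hc : c = 0
    · obtain ⟨A, δ, hA, hδ, e⟩ := exists_factor d
      exact ⟨A, 1, 0, δ, hA, one_ne_zero, Or.inl rfl, hδ, by simp, by simp [hc], by simp [e]⟩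
    · exact ⟨1, c, 1, 0, one_ne_zero, hc, Or.inr rfl, Or.inl rfl, by simp, by simp,
        by simp [hB.resolve_left hc]⟩
  obtain ⟨T, hT, eT⟩ := exists_antideriv hI (f := fun t => l / τ t) (contDiffOn_const.div hτ h)
  obtain ⟨J, hJ, hc⟩ := carries_straighten hI c d hA (l := l) hτ hT
    (fun t ht => by rw [(eT t ht).deriv]; exact div_ne_zero hl (h t ht))
    (fun t ht => by rw [(eT t ht).deriv]; exact div_mul_cancel₀ _ (h t ht))
  refine ⟨J, _, .s1 δ δ', hJ, hc, hδ, hδ', hδδ', span_eq_of_smul hl ?_⟩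
  funext p i
  rw [e2, e1]
  fin_cases i <;> simp [genField, Dt, Ds, Pv] <;> ring

/-- With `τ = 0` and nonzero c the shift equations are algebraic: one divides by c, 2c and 3c in
turn. -/
theorem normalizable_of_dilation (hI : IsOpenInterval I)
    (hχ : ContDiffOn ℝ ∞ χ I) (hρ : ContDiffOn ℝ ∞ ρ I) (hα : ContDiffOn ℝ ∞ α I)
    (hβ : ContDiffOn ℝ ∞ β I) (hσ : ContDiffOn ℝ ∞ σ I) (hc : c ≠ 0) :
    Normalizable I (genField (fun _ => 0) χ ρ α β σ c d) := by
  have ho := hI.2.1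
  have hcc : ∀ {a : ℝ} {f : ℝ → ℝ}, ContDiffOn ℝ ∞ f I → ContDiffOn ℝ ∞ (fun t => f t / a) I :=
    fun hf => hf.div_const _
  obtain ⟨B, hB⟩ := exists_shift_constant c d
  have hX := hcc (a := c) hχ
  have hY := hcc (a := c) hρ
  have hW₁ : ContDiffOn ℝ ∞ (fun t => (α t - deriv (fun t => χ t / c) t * χ t) / (2 * c)) I :=
    hcc (hα.sub ((contDiffOn_deriv ho hX).mul hχ))
  have hW₂ : ContDiffOn ℝ ∞ (fun t => (β t - deriv (fun t => ρ t / c) t * ρ t) / (2 * c)) I :=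
    hcc (hβ.sub ((contDiffOn_deriv ho hY).mul hρ))
  have hW₀ := hcc (a := 3 * c) ((hσ.add (hW₁.mul hχ)).add (hW₂.mul hρ))
  refine ⟨I, genField (fun _ => 0) (fun _ => 0) (fun _ => 0) (fun _ => 0) (fun _ => 0)
    (fun _ => 0) c 0, .s2, hI, carries_shift hI B contDiffOn_const hχ hρ hX hY hW₀ hW₁ hW₂
      ?_ ?_ ?_ ?_ ?_ (hB.resolve_left hc).symm, span_eq_of_smul hc ?_⟩
  · intro t _; simp; field_simp; ring
  · intro t _; simp; field_simp; ring
  · intro t _; simp only [deriv_const']; field_simp; ring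
  · intro t _; simp only [deriv_const']; field_simp; ring
  · intro t _; simp only [deriv_const']; field_simp; ring
  · funext p i
    fin_cases i <;> simp [genField, Ds] <;> ring

/-- With `τ = c = 0` shifts fix χ and ρ. X removes α, W₁ removes σ, and Y removes β if ρ has no
zeros; otherwise β stays as the parameter of the fourth family. A new time then makes χ equal to 1.
-/
theorem normalizable_of_chi_rho_ne_zero (hI : IsOpenInterval I)
    (hχ : ContDiffOn ℝ ∞ χ I) (hρ : ContDiffOn ℝ ∞ ρ I) (hα : ContDiffOn ℝ ∞ α I)
    (hβ : ContDiffOn ℝ ∞ β I) (hσ : ContDiffOn ℝ ∞ σ I) (h : ∀ t ∈ I, χ t ≠ 0)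
    (h' : (∀ t ∈ I, ρ t ≠ 0) ∨ ρ = fun _ => 0) :
    Normalizable I (genField (fun _ => 0) χ ρ α β σ 0 d) := by
  have ho := hI.2.1
  have h0 : ContDiffOn ℝ ∞ (fun _ : ℝ => (0 : ℝ)) I := contDiffOn_const
  obtain ⟨X, hX, eX⟩ := exists_linear_ode hI (p := fun t => deriv χ t / χ t)
    (q := fun t => α t / χ t) ((contDiffOn_deriv ho hχ).div hχ h) (hα.div hχ h)
  obtain ⟨Y, β', hY, hβ', eβ⟩ : ∃ Y β' : ℝ → ℝ, ContDiffOn ℝ ∞ Y I ∧ ContDiffOn ℝ ∞ β' I ∧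
      (∀ t ∈ I, β' t = β t - deriv Y t * ρ t + deriv ρ t * Y t) ∧
      ((∀ t ∈ I, ρ t ≠ 0) → β' = fun _ => 0) := by
    rcases h' with h' | rfl
    · obtain ⟨Y, hY, eY⟩ := exists_linear_ode hI (p := fun t => deriv ρ t / ρ t)
        (q := fun t => β t / ρ t) ((contDiffOn_deriv ho hρ).div hρ h') (hβ.div hρ h')
      refine ⟨Y, fun _ => 0, hY, h0, fun t ht => ?_, fun _ => rfl⟩
      have := h' t ht
      rw [eY t ht]; field_simp; ring
    · obtain ⟨t, ht⟩ := hI.1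
      exact ⟨fun _ => 0, β, h0, hβ, fun t _ => by simp, fun h => (h t ht rfl).elim⟩
  have hW₁ : ContDiffOn ℝ ∞ (fun t => -(σ t + 1 / 2 * deriv χ t * X t ^ 2
      + 1 / 2 * deriv ρ t * Y t ^ 2 - β' t * Y t) / χ t) I :=
    ((((hσ.add ((contDiffOn_const.mul (contDiffOn_deriv ho hχ)).mul (hX.pow 2))).add
      ((contDiffOn_const.mul (contDiffOn_deriv ho hρ)).mul (hY.pow 2))).sub
      (hβ'.mul hY)).neg).div hχ h
  have hshift : Carries I I (genField (fun _ => 0) χ ρ α β σ 0 d)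
      (genField (fun _ => 0) χ ρ (fun _ => 0) β' (fun _ => 0) 0 d) := by
    refine carries_shift hI 0 h0 hχ hρ hX hY h0 hW₁ h0 ?_ ?_ ?_ ?_ ?_ (by simp) <;>
      intro t ht <;> have := h t ht
    · simp
    · simp
    · simp only [deriv_const']; rw [eX t ht]; field_simp; ring
    · simp [eβ.1 t ht]
    · simp only [deriv_const']; field_simp; ring
  refine hshift.normalizable ?_
  obtain ⟨A, δ, hA, hδ, e⟩ := exists_factor d
  -- The scale factor of x must be `1 / χ`; cubing this gives `A ^ 2 * T_t = 1 / χ ^ 3`.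
  obtain ⟨T, hT, eT⟩ := exists_antideriv hI (f := fun t => 1 / (A ^ 2 * χ t ^ 3))
    (contDiffOn_const.div (contDiffOn_const.mul (hχ.pow 3))
      fun t ht => mul_ne_zero (pow_ne_zero 2 hA) (pow_ne_zero 3 (h t ht)))
  have hT' : ∀ t ∈ I, deriv T t ≠ 0 := fun t ht => by
    rw [(eT t ht).deriv]
    exact one_div_ne_zero (mul_ne_zero (pow_ne_zero 2 hA) (pow_ne_zero 3 (h t ht)))
  have ha : ∀ t ∈ I, cbrt A ^ 2 * cbrt (deriv T t) = 1 / χ t := fun t ht => by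
    have h3 : (cbrt A ^ 2 * cbrt (deriv T t)) ^ 3 = (1 / χ t) ^ 3 := by
      have := h t ht
      rw [mul_pow, cbrt_pow_three, ← pow_mul, mul_comm 2 3, pow_mul, cbrt_pow_three,
        (eT t ht).deriv]
      field_simp
    exact (Odd.strictMono_pow (R := ℝ) (n := 3) (by decide)).injective h3
  obtain ⟨J, R, hJ, hRJ, hRT, hTR, hR, hc⟩ := exists_carries_scale hI hA hT hT'
  rcases h' with h' | rfl
  · obtain rfl := eβ.2 h'
    have hρ' : ContDiffOn ℝ ∞ (fun t => ρ (R t) / χ (R t)) J :=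
      (hρ.div hχ h).comp hR hRJ
    refine ⟨J, _, .s3 δ, hJ, hc χ ρ (fun _ => 0) (fun _ => 0) (fun _ => 0) (fun _ => 1)
      (fun t => ρ (R t) / χ (R t)) (fun _ => 0) (fun _ => 0) (fun _ => 0) d hχ hρ
      contDiffOn_const hρ' ?_ ?_ (by simp) (by simp) (by simp), hδ,
      fun t => ρ (R t) / χ (R t), hρ',
      fun t ht => div_ne_zero (h' _ (hRJ ht)) (h _ (hRJ ht)), ?_⟩
    · intro t ht; rw [ha t ht]; exact (one_div_mul_cancel (h t ht)).symm
    · intro t ht; rw [ha t ht, hRT t ht]; ring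
    · congr 2
      funext p i
      rw [e]
      fin_cases i <;> simp [genField, Px, Py, Pv]
  · have hβ'' : ContDiffOn ℝ ∞ (fun t => A ^ 2 * β' (R t) * χ (R t)) J :=
      ((contDiffOn_const.mul hβ').mul hχ).comp hR hRJ
    refine ⟨J, _, .s4 δ, hJ, hc χ (fun _ => 0) (fun _ => 0) β' (fun _ => 0) (fun _ => 1)
      (fun _ => 0) (fun _ => 0) (fun t => A ^ 2 * β' (R t) * χ (R t)) (fun _ => 0) d hχ h0
      contDiffOn_const contDiffOn_const ?_ (by simp) (by simp) ?_ (by simp), hδ, _, hβ'', ?_⟩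
    · intro t ht; rw [ha t ht]; exact (one_div_mul_cancel (h t ht)).symm
    · intro t ht
      have := h t ht
      rw [ha t ht]; simp only [hRT t ht]; field_simp
    · congr 2
      funext p i
      rw [e]
      fin_cases i <;> simp [genField, Px, Ry, Pv]

theorem normalizable_of_alpha_ne_zero (hI : IsOpenInterval I) (hα : ContDiffOn ℝ ∞ α I)
    (hβ : ContDiffOn ℝ ∞ β I) (hσ : ContDiffOn ℝ ∞ σ I) (h : ∀ t ∈ I, α t ≠ 0) :
    Normalizable I (genField (fun _ => 0) (fun _ => 0) (fun _ => 0) α β σ 0 d) := by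
  have h0 : ContDiffOn ℝ ∞ (fun _ : ℝ => (0 : ℝ)) I := contDiffOn_const
  have hX : ContDiffOn ℝ ∞ (fun t => σ t / α t) I := hσ.div hα h
  have hshift : Carries I I (genField (fun _ => 0) (fun _ => 0) (fun _ => 0) α β σ 0 d)
      (genField (fun _ => 0) (fun _ => 0) (fun _ => 0) α β (fun _ => 0) 0 d) := by
    refine carries_shift hI 0 h0 h0 h0 hX h0 h0 h0 h0 ?_ ?_ ?_ ?_ ?_ (by simp) <;>
      intro t ht <;> have := h t ht
    · simp
    · simp
    · simp
    · simp
    · simp only [deriv_const']; field_simp; ring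
  refine hshift.normalizable ?_
  obtain ⟨A, δ, hA, hδ, e⟩ := exists_factor d
  -- The coefficient α becomes 1 when the scale factor of x is `A ^ 2 * α`, that is, when `A ^ 2 *
  -- T_t = A ^ 6 * α ^ 3`.
  obtain ⟨T, hT, eT⟩ := exists_antideriv hI (f := fun t => A ^ 4 * α t ^ 3)
    (contDiffOn_const.mul (hα.pow 3))
  have hT' : ∀ t ∈ I, deriv T t ≠ 0 := fun t ht => by
    rw [(eT t ht).deriv]
    exact mul_ne_zero (pow_ne_zero 4 hA) (pow_ne_zero 3 (h t ht))
  have ha : ∀ t ∈ I, cbrt A ^ 2 * cbrt (deriv T t) = A ^ 2 * α t := fun t ht => by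
    have h3 : (cbrt A ^ 2 * cbrt (deriv T t)) ^ 3 = (A ^ 2 * α t) ^ 3 := by
      rw [mul_pow, cbrt_pow_three, ← pow_mul, mul_comm 2 3, pow_mul, cbrt_pow_three,
        (eT t ht).deriv]
      ring
    exact (Odd.strictMono_pow (R := ℝ) (n := 3) (by decide)).injective h3
  obtain ⟨J, R, hJ, hRJ, hRT, hTR, hR, hc⟩ := exists_carries_scale hI hA hT hT'
  have hβ' : ContDiffOn ℝ ∞ (fun t => β (R t) / α (R t)) J := (hβ.div hα h).comp hR hRJ
  refine ⟨J, _, .s5 δ, hJ, hc (fun _ => 0) (fun _ => 0) α β (fun _ => 0) (fun _ => 0)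
    (fun _ => 0) (fun _ => 1) (fun t => β (R t) / α (R t)) (fun _ => 0) d h0 h0
    contDiffOn_const contDiffOn_const (by simp) (by simp) ?_ ?_ (by simp), hδ, _, hβ', ?_⟩
  · intro t ht; rw [ha t ht]; ring
  · intro t ht
    have := h t ht
    rw [ha t ht]; simp only [hRT t ht]; field_simp
  · congr 2
    funext p i
    rw [e]
    fin_cases i <;> simp [genField, Rx, Ry, Pv]

/-- The function `A ^ 2 * σ` is itself an admissible new time. -/
theorem normalizable_of_deriv_sigma_ne_zero (hI : IsOpenInterval I) (hσ : ContDiffOn ℝ ∞ σ I)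
    (h : ∀ t ∈ I, deriv σ t ≠ 0) :
    Normalizable I (genField (fun _ => 0) (fun _ => 0) (fun _ => 0) (fun _ => 0) (fun _ => 0)
      σ 0 d) := by
  have h0 : ContDiffOn ℝ ∞ (fun _ : ℝ => (0 : ℝ)) I := contDiffOn_const
  obtain ⟨A, δ, hA, hδ, e⟩ := exists_factor d
  have hT : ContDiffOn ℝ ∞ (fun t => A ^ 2 * σ t) I := contDiffOn_const.mul hσ
  have hT' : ∀ t ∈ I, deriv (fun t => A ^ 2 * σ t) t ≠ 0 := fun t ht => by
    rw [deriv_const_mul_field]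
    exact mul_ne_zero (pow_ne_zero 2 hA) (h t ht)
  obtain ⟨J, R, hJ, hRJ, hRT, hTR, hR, hc⟩ := exists_carries_scale hI hA hT hT'
  refine ⟨J, _, .s6 δ, hJ, hc (fun _ => 0) (fun _ => 0) (fun _ => 0) (fun _ => 0) σ
    (fun _ => 0) (fun _ => 0) (fun _ => 0) (fun _ => 0) (fun t => t) d h0 h0
    contDiffOn_const contDiffOn_const (by simp) (by simp) (by simp) (by simp) (by simp), hδ, ?_⟩
  congr 2
  funext p i
  rw [e]
  fin_cases i <;> simp [genField, Z, Pv]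

theorem normalizable_of_const (hI : IsOpenInterval I) {s : ℝ} (h : s ≠ 0 ∨ d ≠ 0) :
    Normalizable I (genField (fun _ => 0) (fun _ => 0) (fun _ => 0) (fun _ => 0) (fun _ => 0)
      (fun _ => s) 0 d) := by
  have h0 : ContDiffOn ℝ ∞ (fun _ : ℝ => (0 : ℝ)) I := contDiffOn_const
  have key : ∀ A : ℝ, A ≠ 0 → ∃ J, IsOpenInterval J ∧ Carries I J
      (genField (fun _ => 0) (fun _ => 0) (fun _ => 0) (fun _ => 0) (fun _ => 0)
        (fun _ => s) 0 d)
      (genField (fun _ => 0) (fun _ => 0) (fun _ => 0) (fun _ => 0) (fun _ => 0)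
        (fun _ => A ^ 2 * s) 0 (A * d)) := fun A hA => by
    obtain ⟨J, R, hJ, -, -, -, -, hc⟩ := exists_carries_scale hI hA (T := fun t => t)
      contDiffOn_id (fun t _ => by simp)
    exact ⟨J, hJ, hc _ _ _ _ _ _ _ _ _ _ d h0 h0 contDiffOn_const contDiffOn_const (by simp)
      (by simp) (by simp) (by simp) (by simp)⟩
  by_cases hs : s = 0
  · subst hs
    obtain ⟨J, hJ, hc⟩ := key 1 one_ne_zero
    refine ⟨J, _, .s8, hJ, hc, span_eq_of_smul (h.resolve_left (fun h => h rfl)) ?_⟩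
    funext p i
    fin_cases i <;> simp [genField, Pv]
  -- Scaling turns the coefficients s, d into `A ^ 2 * s`, `A * d`; they become equal for `A = d /
  -- s`.
  obtain ⟨A, δ, hA, hδ, e⟩ : ∃ A δ : ℝ, A ≠ 0 ∧ (δ = 0 ∨ δ = 1) ∧ A * d = A ^ 2 * s * δ := by
    by_cases hd : d = 0
    · exact ⟨1, 0, one_ne_zero, Or.inl rfl, by simp [hd]⟩
    · exact ⟨d / s, 1, div_ne_zero hd hs, Or.inr rfl, by field_simp⟩
  obtain ⟨J, hJ, hc⟩ := key A hA
  refine ⟨J, _, .s7 δ, hJ, hc, hδ, span_eq_of_smul (mul_ne_zero (pow_ne_zero 2 hA) hs) ?_⟩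
  funext p i
  rw [e]
  fin_cases i <;> simp [genField, Z, Pv]

/-! ### Case distinction by the pivot, and completeness of the list. -/

theorem exists_normalizable_of_vertical {K : Set ℝ} (hK : IsOpenInterval K)
    (hσ : ContDiffOn ℝ ∞ σ K) (h : ¬ ∀ p ∈ slab K, genField (fun _ => 0) (fun _ => 0)
      (fun _ => 0) (fun _ => 0) (fun _ => 0) σ 0 d p = 0) :
    ∃ I, I ⊆ K ∧ IsOpenInterval I ∧ Normalizable I (genField (fun _ => 0) (fun _ => 0)
      (fun _ => 0) (fun _ => 0) (fun _ => 0) σ 0 d) := by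
  by_cases hd : ∀ t ∈ K, deriv σ t = 0
  · obtain ⟨s, hs⟩ := exists_eq_const hK hσ hd
    have e := fun p (hp : p ∈ slab K) => genField_congr hK.2.1
      (eqOn_refl (fun _ => (0 : ℝ)) K) (eqOn_refl (fun _ => (0 : ℝ)) K)
      (eqOn_refl (fun _ => (0 : ℝ)) K) (eqOn_refl (fun _ => (0 : ℝ)) K)
      (eqOn_refl (fun _ => (0 : ℝ)) K) hs (rfl : (0 : ℝ) = 0) (rfl : d = d) hp
    refine ⟨K, Subset.rfl, hK, (normalizable_of_const hK (s := s) ?_).congr e⟩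
    by_contra! hcon
    refine h fun p hp => ?_
    rw [e p hp, hcon.1, hcon.2]
    funext i
    fin_cases i <;> simp [genField]
  · obtain ⟨I, hIK, hI, hne⟩ := exists_openInterval_ne_zero hK
      (contDiffOn_deriv hK.2.1 hσ).continuousOn hd
    exact ⟨I, hIK, hI, normalizable_of_deriv_sigma_ne_zero hI (hσ.mono hIK) hne⟩

/-- The pivots are tried in the order τ, c, χ, ρ, α, β, σ. The exchange of x and y reduces a pivot ρ
or β to a pivot χ or α. If χ is the pivot, a second shrinking may be needed to make ρ either zero or
nowhere zero. -/
theorem exists_normalizable {K : Set ℝ} (hK : IsOpenInterval K)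
    (hτ : ContDiffOn ℝ ∞ τ K) (hχ : ContDiffOn ℝ ∞ χ K) (hρ : ContDiffOn ℝ ∞ ρ K)
    (hα : ContDiffOn ℝ ∞ α K) (hβ : ContDiffOn ℝ ∞ β K) (hσ : ContDiffOn ℝ ∞ σ K)
    (h : ¬ ∀ p ∈ slab K, genField τ χ ρ α β σ c d p = 0) :
    ∃ I, I ⊆ K ∧ IsOpenInterval I ∧ Normalizable I (genField τ χ ρ α β σ c d) := by
  by_cases hτ0 : ∀ t ∈ K, τ t = 0
  swap
  · obtain ⟨I, hIK, hI, hne⟩ := exists_openInterval_ne_zero hK hτ.continuousOn hτ0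
    exact ⟨I, hIK, hI, normalizable_of_tau_ne_zero hI (hτ.mono hIK) (hχ.mono hIK)
      (hρ.mono hIK) (hα.mono hIK) (hβ.mono hIK) (hσ.mono hIK) hne⟩
  by_cases hc : c = 0
  swap
  · refine ⟨K, Subset.rfl, hK, (normalizable_of_dilation (d := d) hK hχ hρ hα hβ hσ hc).congr
      fun p hp => ?_⟩
    exact genField_congr hK.2.1 hτ0 (eqOn_refl _ _) (eqOn_refl _ _) (eqOn_refl _ _)
      (eqOn_refl _ _) (eqOn_refl _ _) rfl rfl hp
  subst hc
  have swapped : ∀ {I : Set ℝ} {χ ρ α β : ℝ → ℝ}, IsOpenInterval I →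
      Normalizable I (genField (fun _ => 0) ρ χ β α σ 0 d) →
      Normalizable I (genField (fun _ => 0) χ ρ α β σ 0 d) := fun hI h =>
    (carries_swap hI _ _ _ _ _ _ _ _).normalizable h
  by_cases hχ0 : ∀ t ∈ K, χ t = 0
  · by_cases hρ0 : ∀ t ∈ K, ρ t = 0
    · have e1 := fun p (hp : p ∈ slab K) => genField_congr hK.2.1 hτ0 hχ0 hρ0 (eqOn_refl α K)
        (eqOn_refl β K) (eqOn_refl σ K) (rfl : (0 : ℝ) = 0) (rfl : d = d) hp
      by_cases hα0 : ∀ t ∈ K, α t = 0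
      · by_cases hβ0 : ∀ t ∈ K, β t = 0
        · have e := fun p (hp : p ∈ slab K) => genField_congr hK.2.1 hτ0 hχ0 hρ0 hα0 hβ0
            (eqOn_refl σ K) (rfl : (0 : ℝ) = 0) (rfl : d = d) hp
          obtain ⟨I, hIK, hI, hn⟩ := exists_normalizable_of_vertical (d := d) hK hσ
            fun h1 => h fun p hp => (e p hp).trans (h1 p hp)
          exact ⟨I, hIK, hI, hn.congr fun p hp => e p (hIK hp)⟩
        · obtain ⟨I, hIK, hI, hne⟩ := exists_openInterval_ne_zero hK hβ.continuousOn hβ0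
          refine ⟨I, hIK, hI, Normalizable.congr (swapped hI (normalizable_of_alpha_ne_zero hI
            (hβ.mono hIK) (hα.mono hIK) (hσ.mono hIK) hne)) fun p hp => e1 p (hIK hp)⟩
      · obtain ⟨I, hIK, hI, hne⟩ := exists_openInterval_ne_zero hK hα.continuousOn hα0
        exact ⟨I, hIK, hI, (normalizable_of_alpha_ne_zero hI (hα.mono hIK) (hβ.mono hIK)
          (hσ.mono hIK) hne).congr fun p hp => e1 p (hIK hp)⟩
    · obtain ⟨I, hIK, hI, hne⟩ := exists_openInterval_ne_zero hK hρ.continuousOn hρ0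
      refine ⟨I, hIK, hI, Normalizable.congr (swapped hI (normalizable_of_chi_rho_ne_zero (d := d) hI
        (hρ.mono hIK) contDiffOn_const (hβ.mono hIK) (hα.mono hIK) (hσ.mono hIK) hne
        (Or.inr rfl))) fun p hp => ?_⟩
      exact genField_congr hK.2.1 hτ0 hχ0 (eqOn_refl _ _) (eqOn_refl _ _)
        (eqOn_refl _ _) (eqOn_refl _ _) rfl rfl (hIK hp)
  · obtain ⟨I, hIK, hI, hne⟩ := exists_openInterval_ne_zero hK hχ.continuousOn hχ0
    by_cases hρ0 : ∀ t ∈ I, ρ t = 0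
    · refine ⟨I, hIK, hI, (normalizable_of_chi_rho_ne_zero (d := d) hI (hχ.mono hIK) contDiffOn_const
        (hα.mono hIK) (hβ.mono hIK) (hσ.mono hIK) hne (Or.inr rfl)).congr fun p hp => ?_⟩
      exact genField_congr hI.2.1 (fun t ht => hτ0 t (hIK ht)) (eqOn_refl _ _) hρ0
        (eqOn_refl _ _) (eqOn_refl _ _) (eqOn_refl _ _) rfl rfl hp
    · obtain ⟨I', hI'I, hI', hne'⟩ := exists_openInterval_ne_zero hI
        (hρ.mono hIK).continuousOn hρ0
      have hK' := hI'I.trans hIK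
      refine ⟨I', hK', hI', (normalizable_of_chi_rho_ne_zero (d := d) hI' (hχ.mono hK') (hρ.mono hK')
        (hα.mono hK') (hβ.mono hK') (hσ.mono hK') (fun t ht => hne t (hI'I ht))
        (Or.inl hne')).congr fun p hp => ?_⟩
      exact genField_congr hI'.2.1 (fun t ht => hτ0 t (hK' ht)) (eqOn_refl _ _) (eqOn_refl _ _)
        (eqOn_refl _ _) (eqOn_refl _ _) (eqOn_refl _ _) rfl rfl hp

end Cases

theorem IsOneDimSubalgebra.exists_glEquivalent {I : Set ℝ} (hI : IsOpenInterval I)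
    {s : Submodule ℝ (VF I)} (hs : IsOneDimSubalgebra I s) {K : Set ℝ} (hK : K ⊆ I)
    (hKo : IsOpenInterval K) (hne : s.map (restrictVF hK) ≠ ⊥) :
    ∃ (I' : Set ℝ) (hI' : I' ⊆ K) (J : Set ℝ) (F : Family) (s' : Submodule ℝ (VF J)),
      IsOpenInterval I' ∧ IsOpenInterval J ∧ IsListed J F s' ∧
      GLEquivalent (s.map (restrictVF (hI'.trans hK))) s' := by
  obtain ⟨hle, -, hrank⟩ := hs
  obtain ⟨⟨Q, hQ⟩, -, hspan⟩ := finrank_eq_one_iff'.1 hrank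
  have hsQ : s = Submodule.span ℝ {Q} := by
    refine le_antisymm (fun R hR => ?_) ((Submodule.span_singleton_le_iff_mem _ _).2 hQ)
    obtain ⟨a, ha⟩ := hspan ⟨R, hR⟩
    exact Submodule.mem_span_singleton.2 ⟨a, congrArg Subtype.val ha⟩
  obtain ⟨τ, χ, ρ, α, β, σ, c, d, hτ, hχ, hρ, hα, hβ, hσ, rfl⟩ :=
    exists_genField_of_mem_gL hI.2.1 (hle hQ)
  have hmap : ∀ {L : Set ℝ} (hL : L ⊆ I), s.map (restrictVF hL) =
      Submodule.span ℝ {(fun p => genField τ χ ρ α β σ c d p.1 : VF L)} := fun hL => by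
    rw [hsQ, Submodule.map_span, image_singleton]; rfl
  obtain ⟨I', hI', hI'o, J, G', F, hJ, hc, hl⟩ := exists_normalizable (c := c) (d := d) hKo
    (hτ.mono hK) (hχ.mono hK) (hρ.mono hK) (hα.mono hK) (hβ.mono hK) (hσ.mono hK) fun h0 => by
      refine hne ?_
      rw [hmap, Submodule.span_singleton_eq_bot]
      funext p
      exact h0 p.1 p.2
  exact ⟨I', hI', J, F, _, hI'o, hJ, hl, hmap (hI'.trans hK) ▸ hc.glEquivalent⟩

end DNLax

theorem mainTheorem3 :
    -- every member of the list is a one-dimensional subalgebra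
    (∀ (I : Set ℝ), DNLax.IsOpenInterval I →
      ∀ (F : DNLax.Family) (s : Submodule ℝ (DNLax.VF I)),
        DNLax.IsListed I F s → DNLax.IsOneDimSubalgebra I s) ∧
    -- the list is complete: locally in `t`, near generic points of the support
    (∀ (I : Set ℝ), DNLax.IsOpenInterval I →
      ∀ s : Submodule ℝ (DNLax.VF I), DNLax.IsOneDimSubalgebra I s →
        ∀ (K : Set ℝ) (hK : K ⊆ I), DNLax.IsOpenInterval K →
          s.map (DNLax.restrictVF hK) ≠ ⊥ →
          ∃ (I' : Set ℝ) (hI' : I' ⊆ K) (J : Set ℝ) (F : DNLax.Family)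
            (s' : Submodule ℝ (DNLax.VF J)),
            DNLax.IsOpenInterval I' ∧ DNLax.IsOpenInterval J ∧ DNLax.IsListed J F s' ∧
            DNLax.GLEquivalent (s.map (DNLax.restrictVF (hI'.trans hK))) s') ∧
    -- members of different families, or with different constant parameters, are inequivalent
    (∀ (I J : Set ℝ), DNLax.IsOpenInterval I → DNLax.IsOpenInterval J →
      ∀ (F F' : DNLax.Family) (s : Submodule ℝ (DNLax.VF I)) (s' : Submodule ℝ (DNLax.VF J)),
        DNLax.IsListed I F s → DNLax.IsListed J F' s' → F ≠ F' →
        ¬ DNLax.GLEquivalent s s') := by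
  refine ⟨fun I hI F s h => h.isOneDimSubalgebra hI, fun I hI s hs K hK hKo hne =>
    hs.exists_glEquivalent hI hK hKo hne, ?_⟩
  intro I J hI hJ F F' s s' h h' hne heq
  exact hne (h.family_eq hI hJ h' heq)
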